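/- Let $d\ge 1$, let $\Omega\subset\mathbb{R}^d$ be open and bounded with boundary $\Gamma=\partial\Omega$, let $\sigma$ be the $(d-1)$-dimensional Hausdorff measure, and assume $\sigma(\Gamma)<\infty$. All functions are complex-valued; $L^2(\Gamma)=L^2(\Gamma,\sigma)$. Let $\beta\in L^\infty(\Gamma)$. For $u\in H^1(\Omega)$ let $\mathrm{Tr}(u)$ be the set of all $\varphi\in L^2(\Gamma)$ for which there is a sequence $(u_n)$ in $C(\overline\Omega)\cap H^1(\Omega)$ with $u_n\to u$ in $H^1(\Omega)$ and $u_n|_\Gamma\to\varphi$ in $L^2(\Gamma)$ (the approximative traces of $u$). For $u\in H^1(\Omega)$ with distributional Laplacian $\Delta u\in L^2(\Omega)$ and for $h\in L^2(\Gamma)$, write $\partial_\nu u=h$ if $\int_\Omega(\Delta u)\overline v+\int_\Omega\nabla u\cdot\overline{\nabla v}=\int_\Gamma h\overline v\,d\sigma$ for all $v\in C(\overline\Omega)\cap H^1(\Omega)$, and write $\partial_\nu u\in L^2(\Gamma)$ if such an $h$ exists. The Wentzell Laplacian $\Delta^W$ in $L^2(\Omega)\oplus L^2(\Gamma)$ is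 given by $$D(\Delta^W)=\{(u,\varphi)\in H^1(\Omega)\oplus L^2(\Gamma):\Delta u\in L^2(\Omega),\ \varphi\in\mathrm{Tr}(u),\ \partial_\nu u\in L^2(\Gamma)\},\qquad \Delta^W(u,\varphi)=(\Delta u,\,-\partial_\nu u-\beta\varphi).$$ Let $V=\{(u,\varphi)\in H^1(\Omega)\oplus L^2(\Gamma):\varphi\in\mathrm{Tr}(u)\}$ with the norm of $H^1(\Omega)\oplus L^2(\Gamma)$. **Theorem.** The part $\Delta^W_V$ of $\Delta^W$ in $V$ is a (single-valued, linear) operator in $V$ and generates a holomorphic $C_0$-semigroup on $V$, that is, a $C_0$-semigroup that, for some $\theta\in(0,\pi/2]$, has a holomorphic extension to the sector $\{z\neq 0:|\arg z|<\theta\}$ which is bounded on $\{z\ne 0: |\arg z|<\theta',\ |z|\le 1\}$ for every $\theta'\in(0,\theta)$. In this realisation the Wentzell condition holds in the sense of traces: explicitly, for $(u,\varphi)\in V$ one has $$(u,\varphi)\in D(\Delta^W_V)\iff \Delta u\in H^1(\Omega),\ \partial_\nu u\in L^2(\Gamma),\ -\partial_\nu u-\beta\varphi\in\mathrm{Tr}(\Delta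 u),$$ and $\Delta^W_V(u,\varphi)=(\Delta u,\,-\partial_\nu u-\beta\varphi)$ for all $(u,\varphi)\in D(\Delta^W_V)$. -/

import Mathlib

open MeasureTheory Filter Topology
open scoped ContDiff

/-! ## Holomorphic `C₀`-semigroups and their generators -/

namespace Semigroup

variable {X : Type*} [NormedAddCommGroup X] [NormedSpace ℂ X]

/-- A strongly continuous one-parameter semigroup of bounded operators on `X`.
Only the values `S t` with `t ≥ 0` are relevant. -/
structure IsC0Semigroup (S : ℝ → X →L[ℂ] X) : Prop where
  map_zero : S 0 = ContinuousLinearMap.id ℂ X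
  map_add : ∀ s t : ℝ, 0 ≤ s → 0 ≤ t → S (s + t) = (S s).comp (S t)
  continuousOn : ∀ x : X, ContinuousOn (fun t : ℝ => S t x) (Set.Ici 0)

/-- The open sector `{z ∈ ℂ ∖ {0} : |arg z| < θ}`. -/
def sector (θ : ℝ) : Set ℂ := {z | z ≠ 0 ∧ |Complex.arg z| < θ}

/-- `S` extends to a holomorphic operator-valued function on some open sector of half-angle
`θ ∈ (0, π/2]`, and the extension is bounded on the part of every strictly smaller sector that lies
in the closed unit disc. -/
def HasHolomorphicExtension (S : ℝ → X →L[ℂ] X) : Prop :=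
  ∃ θ : ℝ, 0 < θ ∧ θ ≤ Real.pi / 2 ∧ ∃ T : ℂ → X →L[ℂ] X,
    DifferentiableOn ℂ T (sector θ) ∧
    (∀ t : ℝ, 0 < t → T (t : ℂ) = S t) ∧
    ∀ θ' : ℝ, 0 < θ' → θ' < θ → ∃ M : ℝ, ∀ z ∈ sector θ', ‖z‖ ≤ 1 → ‖T z‖ ≤ M

/-- The (unbounded) operator `A` is the generator of `S`: one has `x ∈ D(A)` and `A x = y` if and
only if `(S t x - x) / t → y` as `t ↓ 0`. -/
def IsGenerator (A : X →ₗ.[ℂ] X) (S : ℝ → X →L[ℂ] X) : Prop :=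
  ∀ x y : X, (x, y) ∈ A.graph ↔
    Tendsto (fun t : ℝ => ((t : ℂ)⁻¹) • (S t x - x)) (𝓝[>] (0 : ℝ)) (𝓝 y)

/-- The operator `A` generates a holomorphic `C₀`-semigroup on `X`. -/
def GeneratesHolomorphicC0Semigroup (A : X →ₗ.[ℂ] X) : Prop :=
  ∃ S : ℝ → X →L[ℂ] X, IsC0Semigroup S ∧ HasHolomorphicExtension S ∧ IsGenerator A S

end Semigroup

/-- The graph of the part in `Y` of the operator in `X` with graph `G`, where `Y` is a subspace of
`X` by means of the injection `ι : Y → X`: one has `x ∈ Y` in the domain, with image `y`, if and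
only if `x` belongs to the domain of the given operator and its image is the element `y` of `Y`. -/
def partGraph {X Y : Type*} (ι : Y → X) (G : Set (X × X)) : Set (Y × Y) :=
  {p | (ι p.1, ι p.2) ∈ G}

namespace Wentzell

noncomputable section

variable {d : ℕ}

/-- `L²(Ω)`, complex-valued, with respect to Lebesgue measure. -/
abbrev L2Dom (Ω : Set (EuclideanSpace ℝ (Fin d))) : Type :=
  Lp ℂ 2 (volume.restrict Ω)

/-- `L²(Ω; ℂᵈ)`. -/
abbrev L2Vec (Ω : Set (EuclideanSpace ℝ (Fin d))) : Type :=
  Lp (EuclideanSpace ℂ (Fin d)) 2 (volume.restrict Ω)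

/-- The `(d-1)`-dimensional Hausdorff measure `σ` (normalised so as to be the usual surface measure)
on the topological boundary `Γ` of `Ω`. -/
abbrev bdryMeasure (Ω : Set (EuclideanSpace ℝ (Fin d))) : Measure (EuclideanSpace ℝ (Fin d)) :=
  (Measure.euclideanHausdorffMeasure (d - 1)).restrict (frontier Ω)

/-- `L²(Γ) = L²(Γ, σ)`, complex-valued. -/
abbrev L2Bdry (Ω : Set (EuclideanSpace ℝ (Fin d))) : Type :=
  Lp ℂ 2 (bdryMeasure Ω)

/-- `L^∞(Γ) = L^∞(Γ, σ)`, complex-valued. -/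
abbrev LinftyBdry (Ω : Set (EuclideanSpace ℝ (Fin d))) : Type :=
  Lp ℂ ⊤ (bdryMeasure Ω)

/-- Test functions on `Ω`: complex-valued smooth functions with compact support in `Ω`. -/
structure IsTestFunction (Ω : Set (EuclideanSpace ℝ (Fin d)))
    (η : EuclideanSpace ℝ (Fin d) → ℂ) : Prop where
  contDiff : ContDiff ℝ ∞ η
  hasCompactSupport : HasCompactSupport η
  tsupport_subset : tsupport η ⊆ Ω

/-- The `i`-th classical partial derivative. -/
def partialDeriv (i : Fin d) (η : EuclideanSpace ℝ (Fin d) → ℂ) (x : EuclideanSpace ℝ (Fin d)) :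
    ℂ :=
  fderiv ℝ η x (EuclideanSpace.single i 1)

/-- `g ∈ L²(Ω; ℂᵈ)` is the weak gradient of `u ∈ L²(Ω)`. -/
def IsWeakGradient {Ω : Set (EuclideanSpace ℝ (Fin d))} (u : L2Dom Ω) (g : L2Vec Ω) : Prop :=
  ∀ η : EuclideanSpace ℝ (Fin d) → ℂ, IsTestFunction Ω η → ∀ i : Fin d,
    ∫ x in Ω, u x * partialDeriv i η x = -∫ x in Ω, g x i * η x

theorem IsTestFunction.memLp {Ω : Set (EuclideanSpace ℝ (Fin d))}
    {η : EuclideanSpace ℝ (Fin d) → ℂ} (hη : IsTestFunction Ω η) :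
    MemLp η 2 (volume.restrict Ω) :=
  (hη.contDiff.continuous.memLp_of_hasCompactSupport hη.hasCompactSupport).restrict Ω

theorem IsTestFunction.memLp_partialDeriv {Ω : Set (EuclideanSpace ℝ (Fin d))}
    {η : EuclideanSpace ℝ (Fin d) → ℂ} (hη : IsTestFunction Ω η) (i : Fin d) :
    MemLp (partialDeriv i η) 2 (volume.restrict Ω) := by
  have hc : Continuous (partialDeriv i η) :=
    (hη.contDiff.continuous_fderiv (by simp)).clm_apply continuous_const
  have hs : HasCompactSupport (partialDeriv i η) := hη.hasCompactSupport.fderiv_apply ℝ _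
  exact (hc.memLp_of_hasCompactSupport hs).restrict Ω

theorem memLp_coord {Ω : Set (EuclideanSpace ℝ (Fin d))} (g : L2Vec Ω) (i : Fin d) :
    MemLp (fun x => g x i) 2 (volume.restrict Ω) :=
  (Lp.memLp g).continuousLinearMap_comp (EuclideanSpace.proj (𝕜 := ℂ) i)

/-- The Sobolev space `H¹(Ω)` as a subspace of `L²(Ω) ⊕ L²(Ω; ℂᵈ)`. A function `u ∈ H¹(Ω)` is stored together with its weak gradient, so
that the norm of `L²(Ω) ⊕ L²(Ω; ℂᵈ)` restricts to the norm of `H¹(Ω)`. -/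
def H1Submodule (Ω : Set (EuclideanSpace ℝ (Fin d))) :
    Submodule ℂ (WithLp 2 (L2Dom Ω × L2Vec Ω)) where
  carrier := {p | IsWeakGradient p.fst p.snd}
  zero_mem' := by
    intro η _ i
    have e1 : ∫ x in Ω, ((0 : L2Dom Ω) x) * partialDeriv i η x = 0 := by
      apply integral_eq_zero_of_ae
      filter_upwards [Lp.coeFn_zero ℂ 2 (volume.restrict Ω)] with x hx
      rw [hx]
      simp
    have e2 : ∫ x in Ω, ((0 : L2Vec Ω) x) i * η x = 0 := by
      apply integral_eq_zero_of_ae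
      filter_upwards [Lp.coeFn_zero (EuclideanSpace ℂ (Fin d)) 2 (volume.restrict Ω)] with x hx
      rw [hx]
      simp
    simp only [WithLp.zero_fst, WithLp.zero_snd]
    rw [e1, e2, neg_zero]
  add_mem' := by
    intro p q hp hq η hη i
    have e1 : ∫ x in Ω, (p.fst + q.fst) x * partialDeriv i η x
        = (∫ x in Ω, p.fst x * partialDeriv i η x) + ∫ x in Ω, q.fst x * partialDeriv i η x := by
      refine Eq.trans ?_ (integral_add
        ((Lp.memLp p.fst).integrable_mul (hη.memLp_partialDeriv i))
        ((Lp.memLp q.fst).integrable_mul (hη.memLp_partialDeriv i)))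
      apply integral_congr_ae
      filter_upwards [Lp.coeFn_add p.fst q.fst] with x hx
      rw [hx]
      simp only [Pi.add_apply]
      ring
    have e2 : ∫ x in Ω, (p.snd + q.snd) x i * η x
        = (∫ x in Ω, p.snd x i * η x) + ∫ x in Ω, q.snd x i * η x := by
      refine Eq.trans ?_ (integral_add
        ((memLp_coord p.snd i).integrable_mul hη.memLp)
        ((memLp_coord q.snd i).integrable_mul hη.memLp))
      apply integral_congr_ae
      filter_upwards [Lp.coeFn_add p.snd q.snd] with x hx
      rw [hx]
      simp only [Pi.add_apply, PiLp.add_apply]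
      ring
    simp only [WithLp.add_fst, WithLp.add_snd]
    rw [e1, e2, hp η hη i, hq η hη i]
    ring
  smul_mem' := by
    intro c p hp η hη i
    have e1 : ∫ x in Ω, (c • p.fst) x * partialDeriv i η x
        = c * ∫ x in Ω, p.fst x * partialDeriv i η x := by
      rw [← integral_const_mul]
      apply integral_congr_ae
      filter_upwards [Lp.coeFn_smul c p.fst] with x hx
      simp [hx, mul_assoc]
    have e2 : ∫ x in Ω, (c • p.snd) x i * η x = c * ∫ x in Ω, p.snd x i * η x := by
      rw [← integral_const_mul]
      apply integral_congr_ae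
      filter_upwards [Lp.coeFn_smul c p.snd] with x hx
      simp [hx, mul_assoc]
    simp only [WithLp.smul_fst, WithLp.smul_snd]
    rw [e1, e2, hp η hη i]
    ring

/-- The Sobolev space `H¹(Ω)`, with norm `(‖u‖² + ‖∇u‖²)^(1/2)`. -/
abbrev H1 (Ω : Set (EuclideanSpace ℝ (Fin d))) : Type := ↥(H1Submodule Ω)

instance (Ω : Set (EuclideanSpace ℝ (Fin d))) : NormedAddCommGroup (H1 Ω) :=
  Submodule.normedAddCommGroup (H1Submodule Ω)

instance (Ω : Set (EuclideanSpace ℝ (Fin d))) : NormedSpace ℂ (H1 Ω) :=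
  Submodule.normedSpace (H1Submodule Ω)

/-- The element of `L²(Ω)` underlying an element of `H¹(Ω)`. -/
def H1.fn {Ω : Set (EuclideanSpace ℝ (Fin d))} (u : H1 Ω) : L2Dom Ω := u.1.fst

/-- The weak gradient of an element of `H¹(Ω)`. -/
def H1.grad {Ω : Set (EuclideanSpace ℝ (Fin d))} (u : H1 Ω) : L2Vec Ω := u.1.snd

/-- `Δu = f` in the sense of distributions on `Ω`, for `u, f ∈ L²(Ω)`. -/
def HasWeakLaplacian {Ω : Set (EuclideanSpace ℝ (Fin d))} (u f : L2Dom Ω) : Prop :=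
  ∀ η : EuclideanSpace ℝ (Fin d) → ℂ, IsTestFunction Ω η →
    ∫ x in Ω, u x * Laplacian.laplacian η x = ∫ x in Ω, f x * η x

/-- The function `v` (only its values on the closure of `Ω` matter) belongs to
`C(closure Ω) ∩ H¹(Ω)`, and `w` is the corresponding element of `H¹(Ω)`. -/
structure IsContH1 {Ω : Set (EuclideanSpace ℝ (Fin d))} (v : EuclideanSpace ℝ (Fin d) → ℂ)
    (w : H1 Ω) : Prop where
  continuousOn : ContinuousOn v (closure Ω)
  ae_eq : w.fn =ᵐ[volume.restrict Ω] v

/-- The set `Tr(u)` of all approximative traces of `u ∈ H¹(Ω)`: those `φ ∈ L²(Γ)` for which there is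
a sequence `vₙ ∈ C(closure Ω) ∩ H¹(Ω)` such that `vₙ → u` in `H¹(Ω)` and `vₙ|_Γ → φ` in
`L²(Γ)`. Here `wₙ` is the element of `H¹(Ω)` and `ψₙ` is the element of `L²(Γ)` given by `vₙ`. -/
def Tr {Ω : Set (EuclideanSpace ℝ (Fin d))} (u : H1 Ω) : Set (L2Bdry Ω) :=
  {φ | ∃ (v : ℕ → EuclideanSpace ℝ (Fin d) → ℂ) (w : ℕ → H1 Ω) (ψ : ℕ → L2Bdry Ω),
    (∀ n, IsContH1 (v n) (w n)) ∧ (∀ n, ψ n =ᵐ[bdryMeasure Ω] v n) ∧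
    Tendsto w atTop (𝓝 u) ∧ Tendsto ψ atTop (𝓝 φ)}

/-- `∂_ν u = h` for `u ∈ H¹(Ω)` with `Δu ∈ L²(Ω)` and `h ∈ L²(Γ)`, in the sense of
Green's formula. In particular this includes the assertion that `Δu ∈ L²(Ω)`. -/
def HasNormalDeriv {Ω : Set (EuclideanSpace ℝ (Fin d))} (u : H1 Ω) (h : L2Bdry Ω) : Prop :=
  ∃ f : L2Dom Ω, HasWeakLaplacian u.fn f ∧
    ∀ (v : EuclideanSpace ℝ (Fin d) → ℂ) (w : H1 Ω), IsContH1 v w →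
      (∫ x in Ω, f x * starRingEnd ℂ (v x)) +
        (∫ x in Ω, ∑ i : Fin d, u.grad x i * starRingEnd ℂ (w.grad x i)) =
      ∫ z, h z * starRingEnd ℂ (v z) ∂(bdryMeasure Ω)

/-- The Hilbert space `L²(Ω) ⊕ L²(Γ)`. -/
abbrev L2Sum (Ω : Set (EuclideanSpace ℝ (Fin d))) : Type :=
  WithLp 2 (L2Dom Ω × L2Bdry Ω)

/-- The (graph of the) Wentzell Laplacian `Δ^W` in `L²(Ω) ⊕ L²(Γ)`. A pair `(p, q)` belongs to it
if and only if `p = (u, φ)` with `u ∈ H¹(Ω)`, `Δu ∈ L²(Ω)`, `φ ∈ Tr(u)`,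
`∂_ν u ∈ L²(Γ)`, and `q = (Δu, -∂_ν u - β φ)`. -/
def wentzellLaplacian (Ω : Set (EuclideanSpace ℝ (Fin d))) (β : LinftyBdry Ω) :
    Set (L2Sum Ω × L2Sum Ω) :=
  {pq | ∃ (u : H1 Ω) (h : L2Bdry Ω), u.fn = pq.1.fst ∧ pq.1.snd ∈ Tr u ∧
    HasWeakLaplacian u.fn pq.2.fst ∧ HasNormalDeriv u h ∧
    pq.2.snd = -h - (β • pq.1.snd : L2Bdry Ω)}

/-- The subspace `V = {(u, φ) : φ ∈ Tr(u)}` of `H¹(Ω) ⊕ L²(Γ)`, as a submodule. -/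
def VSubmodule (Ω : Set (EuclideanSpace ℝ (Fin d))) :
    Submodule ℂ (WithLp 2 (H1 Ω × L2Bdry Ω)) where
  carrier := {p | p.snd ∈ Tr p.fst}
  zero_mem' := by
    refine ⟨fun _ _ => 0, fun _ => 0, fun _ => 0, fun _ => ⟨continuousOn_const, ?_⟩, fun _ => ?_,
      tendsto_const_nhds, tendsto_const_nhds⟩
    · exact Lp.coeFn_zero _ _ _
    · exact Lp.coeFn_zero _ _ _
  add_mem' := by
    rintro p q ⟨v, w, ψ, h1, h2, h3, h4⟩ ⟨v', w', ψ', h1', h2', h3', h4'⟩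
    refine ⟨fun n => v n + v' n, fun n => w n + w' n, fun n => ψ n + ψ' n,
      fun n => ⟨(h1 n).continuousOn.add (h1' n).continuousOn, ?_⟩, fun n => ?_,
      h3.add h3', h4.add h4'⟩
    · exact (Lp.coeFn_add _ _).trans ((h1 n).ae_eq.add (h1' n).ae_eq)
    · exact (Lp.coeFn_add _ _).trans ((h2 n).add (h2' n))
  smul_mem' := by
    rintro c p ⟨v, w, ψ, h1, h2, h3, h4⟩
    refine ⟨fun n => c • v n, fun n => c • w n, fun n => c • ψ n,
      fun n => ⟨(h1 n).continuousOn.const_smul c, ?_⟩, fun n => ?_,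
      h3.const_smul c, h4.const_smul c⟩
    · exact (Lp.coeFn_smul _ _).trans ((h1 n).ae_eq.const_smul c)
    · exact (Lp.coeFn_smul _ _).trans ((h2 n).const_smul c)

/-- The space `V`, with the norm induced by `H¹(Ω) ⊕ L²(Γ)`. -/
abbrev V (Ω : Set (EuclideanSpace ℝ (Fin d))) : Type := ↥(VSubmodule Ω)

instance (Ω : Set (EuclideanSpace ℝ (Fin d))) : NormedAddCommGroup (V Ω) :=
  Submodule.normedAddCommGroup (VSubmodule Ω)

instance (Ω : Set (EuclideanSpace ℝ (Fin d))) : NormedSpace ℂ (V Ω) :=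
  Submodule.normedSpace (VSubmodule Ω)

/-- The component `u ∈ H¹(Ω)` of `(u, φ) ∈ V`. -/
def V.fn {Ω : Set (EuclideanSpace ℝ (Fin d))} (x : V Ω) : H1 Ω := x.1.fst

/-- The component `φ ∈ L²(Γ)` of `(u, φ) ∈ V`. -/
def V.bdry {Ω : Set (EuclideanSpace ℝ (Fin d))} (x : V Ω) : L2Bdry Ω := x.1.snd

/-- The natural injection of `V` into `L²(Ω) ⊕ L²(Γ)`. -/
def V.toL2Sum {Ω : Set (EuclideanSpace ℝ (Fin d))} (x : V Ω) : L2Sum Ω :=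
  WithLp.toLp 2 (x.fn.fn, x.bdry)

end

end Wentzell

/-! Write `H` for L²(Ω) ⊕ L²(Γ), ι : V → H for the embedding and B(u, φ) = (0, βφ). Green's formula,
extended by density from C(closure Ω) ∩ H¹(Ω) to V, says that Δ^W x = y with x, y ∈ V if and only if
⟪∇v, ∇x⟫ = -⟪ιv, ιy + Bιx⟫ for all v ∈ V (`forall_weakEq_iff`, `StrongEq.weakEq`,
`strongEq_of_weakEq`). The inner product of V is that of H plus the gradient term, so the gradients
can be eliminated: ⟪v, x⟫_V = ⟪ιv, ιx - Bιx - ιy⟫_H (`inner_eq_iff_weakEq`). From here on only an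
injective contraction ι of Hilbert spaces and a bounded operator B matter
(`exists_generator_of_embedding`).

Let A be the resulting operator in V and M = (κ - A)⁻¹. Then x = M g means x = ι*w with w = ιg - (κ
- 1)ιx - Bιx, whence ⟪x, g⟫_V = ‖w‖² + (κ - 1)‖x‖² + ⟪w, Bιx⟫. The first two terms are real and
dominate the third once κ is large. So the numerical range of M, taken in V itself rather than in H,
lies in the sector of half-angle π/4; also M is injective with dense range.

Such an M yields a semigroup (`generatesHolomorphicC0Semigroup`): the operators exp(-z(M + ε)⁻¹) are
contractions for |arg z| ≤ π/4 and converge strongly as ε → 0, with a rate on the range of M². The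
limit is holomorphic inside the sector and has generator -M⁻¹; multiplication by e^{κz} gives the
semigroup of A. -/

namespace Semigroup

/-! ### Exponentials of bounded accretive operators. -/

section Accretive

variable {X : Type*} [NormedAddCommGroup X] [InnerProductSpace ℂ X]

/-- A bounded operator on a complex inner product space whose numerical range lies in the closed
right half-plane. -/
def Accretive (B : X →L[ℂ] X) : Prop := ∀ x, 0 ≤ (inner ℂ (B x) x).re

theorem Accretive.zero : Accretive (0 : X →L[ℂ] X) := fun x => by simp

theorem Accretive.smul {B : X →L[ℂ] X} (hB : Accretive B) {t : ℝ} (ht : 0 ≤ t) :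
    Accretive ((t : ℂ) • B) := fun x => by
  have := mul_nonneg ht (hB x)
  simpa [inner_smul_left] using this

variable [CompleteSpace X]

open NormedSpace (exp)

theorem hasDerivAt_exp_neg_smul (B : X →L[ℂ] X) (t : ℝ) :
    HasDerivAt (fun s : ℝ => exp (-((s : ℂ) • B))) (-(B * exp (-((t : ℂ) • B)))) t := by
  have h := (hasDerivAt_exp_smul_const' (𝕂 := ℂ) (-B) (t : ℂ)).scomp t
    Complex.ofRealCLM.hasDerivAt
  simpa [smul_neg, Function.comp_def] using h

theorem hasDerivAt_exp_neg_smul_apply (B : X →L[ℂ] X) (x : X) (t : ℝ) :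
    HasDerivAt (fun s : ℝ => exp (-((s : ℂ) • B)) x) (-(B (exp (-((t : ℂ) • B)) x))) t := by
  have h := ((ContinuousLinearMap.apply ℂ X x).restrictScalars ℝ).hasFDerivAt.comp_hasDerivAt t
    (hasDerivAt_exp_neg_smul B t)
  simpa [Function.comp_def] using h

/-- Along the orbit u(s) = exp(-sB)x the derivative of ‖u‖² is -2 Re⟪Bu, u⟫ ≤ 0. -/
theorem Accretive.norm_exp_neg_apply_le {B : X →L[ℂ] X} (hB : Accretive B) (x : X) :
    ‖exp (-B) x‖ ≤ ‖x‖ := by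
  have hd : ∀ t : ℝ, HasDerivAt (fun s : ℝ => ‖exp (-((s : ℂ) • B)) x‖ ^ 2)
      (-(2 * (inner ℂ (B (exp (-((t : ℂ) • B)) x)) (exp (-((t : ℂ) • B)) x)).re)) t := by
    intro t
    have h1 := hasDerivAt_exp_neg_smul_apply B x t
    have h2 := Complex.reCLM.hasFDerivAt.comp_hasDerivAt t (h1.inner ℂ h1)
    refine (h2.congr_deriv ?_).congr_of_eventuallyEq (Eventually.of_forall fun s => ?_)
    · have h3 := inner_re_symm (𝕜 := ℂ) (exp (-((t : ℂ) • B)) x) (B (exp (-((t : ℂ) • B)) x))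
      simp only [RCLike.re_eq_complex_re] at h3
      simp only [Complex.reCLM_apply, inner_neg_right, inner_neg_left, Complex.add_re,
        Complex.neg_re, h3]
      ring
    · exact norm_sq_eq_re_inner (𝕜 := ℂ) _
  have hanti : Antitone (fun s : ℝ => ‖exp (-((s : ℂ) • B)) x‖ ^ 2) := by
    apply antitone_of_deriv_nonpos (fun t => (hd t).differentiableAt)
    intro t
    rw [(hd t).deriv]
    linarith [hB (exp (-((t : ℂ) • B)) x)]
  have h := hanti zero_le_one
  simp only [Complex.ofReal_one, one_smul, Complex.ofReal_zero, zero_smul, neg_zero,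
    NormedSpace.exp_zero, one_apply_eq_self] at h
  exact le_of_sq_le_sq h (norm_nonneg _)

/-- The exponentials of two commuting accretive operators differ at `x` by at most the difference
of the operators. -/
theorem Accretive.norm_exp_neg_sub_le {P Q : X →L[ℂ] X} (hP : Accretive P) (hQ : Accretive Q)
    (hPQ : Commute P Q) (x : X) : ‖exp (-P) x - exp (-Q) x‖ ≤ ‖P x - Q x‖ := by
  -- This path joins exp(-Q)x at s = 0 to exp(-P)x at s = 1. By commutativity its derivative is the
  -- same product of contractions applied to Qx - Px.
  set g : ℝ → X := fun s => exp (-((s : ℂ) • P)) (exp (-(((1 - s : ℝ) : ℂ) • Q)) x) with hg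
  set g' : ℝ → X := fun s =>
    exp (-((s : ℂ) • P)) (exp (-(((1 - s : ℝ) : ℂ) • Q)) (Q x - P x)) with hg'
  have hcP : ∀ s : ℝ, Commute P (exp (-((s : ℂ) • P))) := fun s =>
    (((Commute.refl P).smul_right (s : ℂ)).neg_right).exp_right
  have hcPQ : ∀ s : ℝ, Commute P (exp (-((s : ℂ) • Q))) := fun s =>
    ((hPQ.smul_right (s : ℂ)).neg_right).exp_right
  have hcQ : ∀ s : ℝ, Commute Q (exp (-((s : ℂ) • Q))) := fun s =>
    (((Commute.refl Q).smul_right (s : ℂ)).neg_right).exp_right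
  have hd : ∀ s : ℝ, HasDerivAt g (g' s) s := by
    intro s
    have h1 := hasDerivAt_exp_neg_smul P s
    have h2 : HasDerivAt (fun s : ℝ => exp (-(((1 - s : ℝ) : ℂ) • Q)))
        (Q * exp (-(((1 - s : ℝ) : ℂ) • Q))) s := by
      have := (hasDerivAt_exp_neg_smul Q (1 - s)).scomp s ((hasDerivAt_id s).const_sub 1)
      rw [neg_smul, one_smul, neg_neg] at this
      exact this
    have h3 := ((ContinuousLinearMap.apply ℂ X x).restrictScalars ℝ).hasFDerivAt.comp_hasDerivAt s
      (h1.mul h2)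
    refine (h3.congr_deriv ?_).congr_of_eventuallyEq (Eventually.of_forall fun t => rfl)
    have e1 : P * exp (-((s : ℂ) • P)) * exp (-(((1 - s : ℝ) : ℂ) • Q))
        = exp (-((s : ℂ) • P)) * exp (-(((1 - s : ℝ) : ℂ) • Q)) * P := by
      rw [(hcP s).eq, mul_assoc, (hcPQ (1 - s)).eq, mul_assoc]
    have e2 : exp (-((s : ℂ) • P)) * (Q * exp (-(((1 - s : ℝ) : ℂ) • Q)))
        = exp (-((s : ℂ) • P)) * exp (-(((1 - s : ℝ) : ℂ) • Q)) * Q := by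
      rw [(hcQ (1 - s)).eq, mul_assoc]
    rw [neg_mul, e1, e2]
    simp only [ContinuousLinearMap.coe_restrictScalars', ContinuousLinearMap.apply_apply,
      add_apply, neg_apply, ContinuousLinearMap.mul_def,
      ContinuousLinearMap.comp_apply, hg', map_sub]
    abel
  have h := norm_image_sub_le_of_norm_deriv_le_segment_01' (f := g) (f' := g') (C := ‖P x - Q x‖)
    (fun s _ => (hd s).hasDerivWithinAt) (fun s hs => by
      calc ‖g' s‖ ≤ ‖exp (-(((1 - s : ℝ) : ℂ) • Q)) (Q x - P x)‖ :=
            (hP.smul hs.1).norm_exp_neg_apply_le _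
        _ ≤ ‖Q x - P x‖ := (hQ.smul (by linarith [hs.2])).norm_exp_neg_apply_le _
        _ = ‖P x - Q x‖ := norm_sub_rev _ _)
  simpa [hg] using h

theorem Accretive.norm_exp_neg_sub_self_le {P : X →L[ℂ] X} (hP : Accretive P) (x : X) :
    ‖exp (-P) x - x‖ ≤ ‖P x‖ := by
  simpa using hP.norm_exp_neg_sub_le Accretive.zero (Commute.zero_right P) x

/-- First-order Taylor remainder: the derivative of exp(-sP)x + sPx is -(exp(-sP)Px - Px). -/
theorem norm_exp_neg_sub_add_le {P : X →L[ℂ] X} {x : X} {C : ℝ}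
    (hC : ∀ s : ℝ, 0 ≤ s → s ≤ 1 → ‖exp (-((s : ℂ) • P)) (P x) - P x‖ ≤ C) :
    ‖exp (-P) x - x + P x‖ ≤ C := by
  have hd : ∀ s : ℝ, HasDerivAt (fun s : ℝ => exp (-((s : ℂ) • P)) x + s • P x)
      (-(exp (-((s : ℂ) • P)) (P x) - P x)) s := by
    intro s
    have hc : Commute P (exp (-((s : ℂ) • P))) :=
      (((Commute.refl P).smul_right (s : ℂ)).neg_right).exp_right
    have := (hasDerivAt_exp_neg_smul_apply P x s).add ((hasDerivAt_id s).smul_const (P x))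
    refine this.congr_deriv ?_
    have e := congrArg (fun L : X →L[ℂ] X => L x) hc.eq
    simp only [ContinuousLinearMap.mul_def, ContinuousLinearMap.comp_apply] at e
    rw [e, one_smul]
    abel
  have h := norm_image_sub_le_of_norm_deriv_le_segment_01' (C := C)
    (fun s _ => (hd s).hasDerivWithinAt) (fun s hs => by
      rw [norm_neg]; exact hC s hs.1 hs.2.le)
  refine le_trans (le_of_eq ?_) h
  congr 1
  simp
  abel

theorem Accretive.norm_exp_neg_sub_add_le_sq {P : X →L[ℂ] X} (hP : Accretive P) (x : X) :
    ‖exp (-P) x - x + P x‖ ≤ ‖P (P x)‖ := by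
  refine Semigroup.norm_exp_neg_sub_add_le fun s hs hs1 => ?_
  refine ((hP.smul hs).norm_exp_neg_sub_self_le _).trans ?_
  rw [smul_apply, norm_smul, Complex.norm_real, Real.norm_of_nonneg hs]
  exact mul_le_of_le_one_left (norm_nonneg _) hs1

/-- Cruder companion of the quadratic bound, needed for vectors x on which P² is not controlled. -/
theorem Accretive.norm_exp_neg_sub_add_le_two_mul {P : X →L[ℂ] X} (hP : Accretive P) (x : X) :
    ‖exp (-P) x - x + P x‖ ≤ 2 * ‖P x‖ := by
  refine Semigroup.norm_exp_neg_sub_add_le fun s hs hs1 => ?_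
  have := (hP.smul hs).norm_exp_neg_apply_le (P x)
  linarith [norm_sub_le (exp (-((s : ℂ) • P)) (P x)) (P x)]

end Accretive

/-! ### From strong to operator-norm holomorphy. -/

section StrongHolomorphic

variable {X Y : Type*} [NormedAddCommGroup X] [NormedSpace ℂ X]
  [NormedAddCommGroup Y] [NormedSpace ℂ Y] [CompleteSpace Y]

/-- A bounded strongly holomorphic operator-valued function is holomorphic in operator norm. -/
theorem differentiableOn_of_strong {U : Set ℂ} (hU : IsOpen U) {T : ℂ → X →L[ℂ] Y} {C : ℝ}
    (hT : ∀ x, DifferentiableOn ℂ (fun z => T z x) U) (hC : ∀ z ∈ U, ‖T z‖ ≤ C) :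
    DifferentiableOn ℂ T U := by
  intro c hc
  have hC0 : 0 ≤ C := (norm_nonneg _).trans (hC c hc)
  obtain ⟨ρ, hρ, hball⟩ := Metric.isOpen_iff.1 hU c hc
  -- The Schwarz lemma for each orbit has a constant proportional to ‖x‖, so it gives a Lipschitz
  -- bound in operator norm.
  have hlip : ∀ z ∈ U, ∀ r > 0, Metric.ball z r ⊆ U → ∀ w ∈ Metric.ball z r,
      ‖T w - T z‖ ≤ (2 * C) / r * dist w z := by
    intro z hz r hr hzr w hw
    refine ContinuousLinearMap.opNorm_le_bound _ (by positivity) fun x => ?_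
    have hmaps : Set.MapsTo (fun z => T z x) (Metric.ball z r)
        (Metric.closedBall (T z x) (2 * C * ‖x‖)) := by
      intro v hv
      rw [Metric.mem_closedBall, dist_eq_norm]
      have h1 := (T v).le_of_opNorm_le (hC v (hzr hv)) x
      have h2 := (T z).le_of_opNorm_le (hC z hz) x
      linarith [norm_sub_le (T v x) (T z x)]
    have h := Complex.dist_le_div_mul_dist_of_mapsTo_ball ((hT x).mono hzr) hmaps hw
    rw [dist_eq_norm] at h
    refine h.trans (le_of_eq ?_)
    ring
  have hcont : ContinuousOn T U := by
    intro z hz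
    obtain ⟨r, hr, hzr⟩ := Metric.isOpen_iff.1 hU z hz
    refine ContinuousAt.continuousWithinAt ?_
    rw [ContinuousAt, tendsto_iff_norm_sub_tendsto_zero]
    refine squeeze_zero' (Eventually.of_forall fun _ => norm_nonneg _) (g := fun w =>
      (2 * C) / r * dist w z) ?_ ?_
    · filter_upwards [Metric.ball_mem_nhds z hr] with w hw using hlip z hz r hr hzr w hw
    · have : Tendsto (fun w => (2 * C) / r * dist w z) (𝓝 z) (𝓝 ((2 * C) / r * dist z z)) :=
        (continuous_const.mul (continuous_id.dist continuous_const)).tendsto z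
      simpa using this
  have hR : 0 < ρ / 2 := half_pos hρ
  have hsub : Metric.closedBall c (ρ / 2) ⊆ U :=
    (Metric.closedBall_subset_ball (half_lt_self hρ)).trans hball
  have hci : CircleIntegrable T c (ρ / 2) :=
    (hcont.mono (Metric.sphere_subset_closedBall.trans hsub)).circleIntegrable hR.le
  have hF := hasFPowerSeriesOn_cauchy_integral (R := ⟨ρ / 2, hR.le⟩) hci hR
  refine DifferentiableAt.differentiableWithinAt ?_
  refine (hF.differentiableOn.differentiableAt
    (Metric.eball_mem_nhds _ (ENNReal.coe_pos.2 hR))).congr_of_eventuallyEq ?_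
  -- The norm-valued Cauchy integral is analytic; it equals T because Cauchy's formula holds for
  -- every orbit.
  filter_upwards [Metric.ball_mem_nhds c hR] with w hw
  ext x
  have hd : DiffContOnCl ℂ (fun z => T z x) (Metric.ball c (ρ / 2)) :=
    ((hT x).mono (by rwa [closure_ball _ hR.ne'])).diffContOnCl
  rw [← hd.two_pi_i_inv_smul_circleIntegral_sub_inv_smul hw]
  have hint : CircleIntegrable (fun z => (z - w)⁻¹ • T z) c (ρ / 2) := by
    refine ContinuousOn.circleIntegrable hR.le (ContinuousOn.smul
      (ContinuousOn.inv₀ (f := fun z => z - w) (by fun_prop) ?_)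
      (hcont.mono (Metric.sphere_subset_closedBall.trans hsub)))
    intro z hz h0
    rw [sub_eq_zero] at h0
    rw [h0, Metric.mem_sphere] at hz
    exact (Metric.mem_ball.1 hw).ne hz
  rw [smul_apply]
  congr 1
  rw [circleIntegral, circleIntegral, ContinuousLinearMap.intervalIntegral_apply]
  · rfl
  · exact hint.out

end StrongHolomorphic

theorem commute_ringInverse_right {R : Type*} [MonoidWithZero R] {a b : R} (h : Commute a b) :
    Commute a (Ring.inverse b) := by
  by_cases hb : IsUnit b
  · obtain ⟨u, rfl⟩ := hb
    rw [Ring.inverse_unit]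
    exact h.units_inv_right
  · rw [Ring.inverse_non_unit _ hb]
    exact Commute.zero_right a

/-! ### Sectorial operators, their Yosida approximations and the approximating semigroups. -/

section Sectorial

variable {X : Type*} [NormedAddCommGroup X] [InnerProductSpace ℂ X]

/-- A bounded operator whose numerical range lies in the closed sector of half-angle `π / 4`. -/
def Sectorial (M : X →L[ℂ] X) : Prop := ∀ x, |(inner ℂ (M x) x).im| ≤ (inner ℂ (M x) x).re

/-- The closed sector of half-angle `π / 4`. -/
def cone : Set ℂ := {z | |z.im| ≤ z.re}

theorem zero_mem_cone : (0 : ℂ) ∈ cone := by simp [cone]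

theorem ofReal_mem_cone {t : ℝ} (ht : 0 ≤ t) : (t : ℂ) ∈ cone := by simpa [cone] using ht

theorem add_mem_cone {z w : ℂ} (hz : z ∈ cone) (hw : w ∈ cone) : z + w ∈ cone := by
  simp only [cone, Set.mem_ofPred_eq, Complex.add_re, Complex.add_im] at *
  linarith [abs_add_le z.im w.im]

/-- The interior of `cone`. -/
def openCone : Set ℂ := {z | |z.im| < z.re}

theorem isOpen_openCone : IsOpen openCone :=
  isOpen_lt (continuous_abs.comp Complex.continuous_im) Complex.continuous_re

theorem openCone_subset_cone : openCone ⊆ cone := fun _ hz => le_of_lt (Set.mem_ofPred.1 hz)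

theorem sector_pi_div_four_subset : sector (Real.pi / 4) ⊆ openCone := by
  rintro z ⟨hz, harg⟩
  obtain ⟨h1, h2⟩ := abs_lt.1 harg
  have hn : 0 < ‖z‖ := norm_pos_iff.2 hz
  have hre : z.re = ‖z‖ * Real.cos z.arg := (Complex.norm_mul_cos_arg z).symm
  have him : z.im = ‖z‖ * Real.sin z.arg := (Complex.norm_mul_sin_arg z).symm
  have hs2 : 0 < Real.sqrt 2 := by positivity
  have hpi := Real.pi_pos
  have hs : |Real.sin z.arg| < Real.sqrt 2 / 2 := by
    rw [abs_lt, ← Real.sin_pi_div_four, ← Real.sin_neg]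
    constructor <;> apply Real.sin_lt_sin_of_lt_of_le_pi_div_two <;> linarith
  have hc : Real.sqrt 2 / 2 < Real.cos z.arg := by
    rw [← Real.cos_pi_div_four, ← Real.cos_abs z.arg]
    exact Real.cos_lt_cos_of_nonneg_of_le_pi (abs_nonneg _) (by linarith) harg
  change |z.im| < z.re
  rw [hre, him, abs_mul, abs_of_pos hn]
  exact mul_lt_mul_of_pos_left (hs.trans hc) hn

variable {M : X →L[ℂ] X}

theorem Sectorial.accretive (hM : Sectorial M) : Accretive M := fun x => (abs_nonneg _).trans (hM x)

/-- Two arguments of size at most π/4 add up to at most π/2, so the real part stays nonnegative. -/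
theorem Sectorial.accretive_smul (hM : Sectorial M) {z : ℂ} (hz : z ∈ cone) :
    Accretive (z • M) := fun x => by
  have h := hM x
  simp only [cone, Set.mem_ofPred_eq] at hz
  rw [smul_apply, inner_smul_left, Complex.mul_re, Complex.conj_re, Complex.conj_im]
  have h1 : |z.im * (inner ℂ (M x) x).im| ≤ z.re * (inner ℂ (M x) x).re := by
    rw [abs_mul]
    exact mul_le_mul hz h (abs_nonneg _) ((abs_nonneg _).trans hz)
  linarith [neg_abs_le (z.im * (inner ℂ (M x) x).im)]

theorem Accretive.mul_norm_le {B : X →L[ℂ] X} (hB : Accretive B) (ε : ℝ) (x : X) :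
    ε * ‖x‖ ≤ ‖B x + (ε : ℂ) • x‖ := by
  rcases eq_or_ne x 0 with rfl | hx
  · simp
  have hn : 0 < ‖x‖ := norm_pos_iff.2 hx
  have h1 : ε * ‖x‖ ^ 2 ≤ (inner ℂ (B x + (ε : ℂ) • x) x).re := by
    rw [inner_add_left, inner_smul_left, Complex.conj_ofReal, inner_self_eq_norm_sq_to_K,
      Complex.add_re]
    have h2 : (((ε : ℂ) * (((‖x‖ : ℝ) : ℂ)) ^ 2)).re = ε * ‖x‖ ^ 2 := by
      rw [← Complex.ofReal_pow, ← Complex.ofReal_mul, Complex.ofReal_re]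
    have h3 := hB x
    simp only [Complex.coe_algebraMap] at *
    linarith
  have h2 : (inner ℂ (B x + (ε : ℂ) • x) x).re ≤ ‖B x + (ε : ℂ) • x‖ * ‖x‖ :=
    (Complex.re_le_norm _).trans (norm_inner_le_norm _ _)
  refine le_of_mul_le_mul_right ?_ hn
  linarith

theorem exists_norm_sub_apply_lt (hd : DenseRange M) (x : X) {η : ℝ} (hη : 0 < η) :
    ∃ v, ‖x - M v‖ < η := by
  obtain ⟨v, hv⟩ := hd.exists_dist_lt x hη
  exact ⟨v, by rwa [← dist_eq_norm]⟩

/-- The range of M² plays the role of the domain of the square of M⁻¹; there the Yosida semigroups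
converge at rate ε. -/
theorem exists_norm_sub_apply_apply_lt (hd : DenseRange M) (x : X) {η : ℝ} (hη : 0 < η) :
    ∃ v, ‖x - M (M v)‖ < η := by
  obtain ⟨v, hv⟩ := (hd.comp hd M.continuous).exists_dist_lt x hη
  exact ⟨v, by rwa [← dist_eq_norm]⟩

variable [CompleteSpace X]

/-- Lax–Milgram: the shifted operator is coercive with constant ε. -/
theorem Accretive.isUnit_add_smul_one {B : X →L[ℂ] X} (hB : Accretive B) {ε : ℝ} (hε : 0 < ε) :
    IsUnit (B + (ε : ℂ) • (1 : X →L[ℂ] X)) := by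
  refine ContinuousLinearMap.isUnit_of_forall_le_norm_inner_map _ (c := ⟨ε, hε.le⟩) hε fun x => ?_
  refine le_trans ?_ (Complex.re_le_norm _)
  have h2 : (((ε : ℂ) * (((‖x‖ : ℝ) : ℂ)) ^ 2)).re = ε * ‖x‖ ^ 2 := by
    rw [← Complex.ofReal_pow, ← Complex.ofReal_mul, Complex.ofReal_re]
  have h3 := hB x
  simp only [add_apply, smul_apply, one_apply_eq_self, inner_add_left, inner_smul_left,
    Complex.conj_ofReal, inner_self_eq_norm_sq_to_K, Complex.add_re, Complex.coe_algebraMap] at *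
  rw [h2]
  change ‖x‖ ^ 2 * ε ≤ _
  linarith

/-- The Yosida approximation `(M + ε)⁻¹` of the (unbounded) inverse of `M`. -/
noncomputable def yosida (M : X →L[ℂ] X) (ε : ℝ) : X →L[ℂ] X :=
  Ring.inverse (M + (ε : ℂ) • (1 : X →L[ℂ] X))

theorem yosida_apply_add (hM : Accretive M) {ε : ℝ} (hε : 0 < ε) (x : X) :
    yosida M ε (M x) + (ε : ℂ) • yosida M ε x = x := by
  have h := congrArg (fun L : X →L[ℂ] X => L x)
    (Ring.inverse_mul_cancel _ (hM.isUnit_add_smul_one hε))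
  simpa [yosida, ContinuousLinearMap.mul_def] using h

theorem apply_yosida_add (hM : Accretive M) {ε : ℝ} (hε : 0 < ε) (x : X) :
    M (yosida M ε x) + (ε : ℂ) • yosida M ε x = x := by
  have h := congrArg (fun L : X →L[ℂ] X => L x)
    (Ring.mul_inverse_cancel _ (hM.isUnit_add_smul_one hε))
  simpa [yosida, ContinuousLinearMap.mul_def] using h

omit [CompleteSpace X] in
theorem commute_yosida (M : X →L[ℂ] X) (ε : ℝ) : Commute M (yosida M ε) :=
  commute_ringInverse_right ((Commute.refl M).add_right ((Commute.one_right M).smul_right _))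

omit [CompleteSpace X] in
theorem commute_yosida_yosida (M : X →L[ℂ] X) (ε δ : ℝ) : Commute (yosida M ε) (yosida M δ) :=
  commute_ringInverse_right ((commute_yosida M ε).symm.add_right
    ((Commute.one_right _).smul_right _))

theorem mul_norm_yosida_le (hM : Accretive M) {ε : ℝ} (hε : 0 < ε) (x : X) :
    ε * ‖yosida M ε x‖ ≤ ‖x‖ := by
  simpa only [apply_yosida_add hM hε] using hM.mul_norm_le ε (yosida M ε x)

/-- From (M + ε)⁻¹M = 1 - ε(M + ε)⁻¹. -/
theorem norm_yosida_apply_sub (hM : Accretive M) {ε : ℝ} (hε : 0 < ε) (x : X) :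
    ‖yosida M ε (M x) - x‖ = ε * ‖yosida M ε x‖ := by
  have h : yosida M ε (M x) - x = -((ε : ℂ) • yosida M ε x) := by
    nth_rewrite 2 [← yosida_apply_add hM hε x]
    abel
  rw [h, norm_neg, norm_smul, Complex.norm_real, Real.norm_of_nonneg hε.le]

theorem norm_yosida_apply_le (hM : Accretive M) {ε : ℝ} (hε : 0 < ε) (x : X) :
    ‖yosida M ε (M x)‖ ≤ 2 * ‖x‖ := by
  have h1 := norm_yosida_apply_sub hM hε x
  have h2 := mul_norm_yosida_le hM hε x
  have h3 := norm_sub_norm_le (yosida M ε (M x)) x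
  linarith

theorem norm_yosida_apply_apply_sub_le (hM : Accretive M) {ε : ℝ} (hε : 0 < ε) (x : X) :
    ‖yosida M ε (M (M x)) - M x‖ ≤ 2 * ε * ‖x‖ := by
  rw [norm_yosida_apply_sub hM hε]
  nlinarith [norm_yosida_apply_le hM hε x]

/-- With x = My + εy one has ⟪y, x⟫ = conj ⟪My, y⟫ + ε‖y‖²; conjugation preserves the sector, and a
nonnegative real shift stays in it. -/
theorem Sectorial.yosida (hM : Sectorial M) {ε : ℝ} (hε : 0 < ε) : Sectorial (yosida M ε) := by
  intro x
  set y := Semigroup.yosida M ε x with hy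
  have hx : M y + (ε : ℂ) • y = x := apply_yosida_add hM.accretive hε x
  have h1 : inner ℂ y x = (starRingEnd ℂ) (inner ℂ (M y) y) + ((ε * ‖y‖ ^ 2 : ℝ) : ℂ) := by
    rw [← hx, inner_add_right, inner_smul_right, inner_self_eq_norm_sq_to_K, inner_conj_symm]
    simp
  rw [h1, Complex.add_re, Complex.add_im, Complex.conj_re, Complex.conj_im, Complex.ofReal_re,
    Complex.ofReal_im, add_zero, abs_neg]
  have := hM y
  have : 0 ≤ ε * ‖y‖ ^ 2 := by positivity
  linarith

open NormedSpace (exp)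

/-- The approximating parameters `1 / (n + 1)`. -/
noncomputable def eps (n : ℕ) : ℝ := 1 / ((n : ℝ) + 1)

theorem eps_pos (n : ℕ) : 0 < eps n := Nat.one_div_pos_of_nat

theorem tendsto_eps : Tendsto eps atTop (𝓝 0) := tendsto_one_div_add_atTop_nhds_zero_nat

/-- The semigroups generated by the Yosida approximations. -/
noncomputable def approx (M : X →L[ℂ] X) (n : ℕ) (z : ℂ) : X →L[ℂ] X :=
  exp (-(z • yosida M (eps n)))

theorem Sectorial.accretive_smul_yosida (hM : Sectorial M) (n : ℕ) {z : ℂ} (hz : z ∈ cone) :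
    Accretive (z • Semigroup.yosida M (eps n)) := (hM.yosida (eps_pos n)).accretive_smul hz

theorem Sectorial.norm_approx_apply_le (hM : Sectorial M) (n : ℕ) {z : ℂ} (hz : z ∈ cone) (x : X) :
    ‖approx M n z x‖ ≤ ‖x‖ := (hM.accretive_smul_yosida n hz).norm_exp_neg_apply_le x

theorem approx_zero (M : X →L[ℂ] X) (n : ℕ) : approx M n 0 = 1 := by
  simp [approx]

theorem approx_add (M : X →L[ℂ] X) (n : ℕ) (z w : ℂ) (x : X) :
    approx M n (z + w) x = approx M n z (approx M n w x) := by
  have : approx M n (z + w) = approx M n z * approx M n w := by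
    let : NormedAlgebra ℚ (X →L[ℂ] X) := NormedAlgebra.restrictScalars ℚ ℂ _
    rw [approx, add_smul, neg_add, NormedSpace.exp_add_of_commute]
    · rfl
    · exact ((((Commute.refl _).smul_right _).smul_left _).neg_left).neg_right
  rw [this]
  rfl

theorem apply_approx (M : X →L[ℂ] X) (n : ℕ) (z : ℂ) (x : X) :
    M (approx M n z x) = approx M n z (M x) := by
  have h : Commute M (approx M n z) :=
    (((commute_yosida M (eps n)).smul_right z).neg_right).exp_right
  exact congrArg (fun L : X →L[ℂ] X => L x) h.eq

theorem differentiable_approx (M : X →L[ℂ] X) (n : ℕ) (x : X) :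
    Differentiable ℂ (fun z => approx M n z x) := by
  intro z
  have h := (hasDerivAt_exp_smul_const' (𝕂 := ℂ) (-yosida M (eps n)) z).differentiableAt
  have h2 := (ContinuousLinearMap.apply ℂ X x).differentiableAt.comp z h
  simpa [Function.comp_def, smul_neg, approx] using h2

/-- Split x into M²v and a remainder. Contractivity handles the remainder; on M²v the difference of
the commuting exponentials is at most that of their exponents, both of which are close to zMv. -/
theorem Sectorial.norm_approx_sub_approx_le (hM : Sectorial M) (m n : ℕ) {z : ℂ} (hz : z ∈ cone)
    (x v : X) : ‖approx M n z x - approx M m z x‖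
      ≤ 2 * ‖x - M (M v)‖ + 2 * ‖z‖ * (eps n + eps m) * ‖v‖ := by
  have h1 : ‖approx M n z (M (M v)) - approx M m z (M (M v))‖
      ≤ 2 * ‖z‖ * (eps n + eps m) * ‖v‖ := by
    refine ((hM.accretive_smul_yosida n hz).norm_exp_neg_sub_le (hM.accretive_smul_yosida m hz)
      (((commute_yosida_yosida M _ _).smul_right _).smul_left _) _).trans ?_
    rw [smul_apply, smul_apply, ← smul_sub, norm_smul]
    have h2 := norm_yosida_apply_apply_sub_le hM.accretive (eps_pos n) v
    have h3 := norm_yosida_apply_apply_sub_le hM.accretive (eps_pos m) v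
    have h4 := norm_sub_le_norm_sub_add_norm_sub (Semigroup.yosida M (eps n) (M (M v))) (M v)
      (Semigroup.yosida M (eps m) (M (M v)))
    rw [norm_sub_rev (M v)] at h4
    calc _ ≤ ‖z‖ * (2 * eps n * ‖v‖ + 2 * eps m * ‖v‖) := by gcongr; linarith
      _ = _ := by ring
  have h2 := hM.norm_approx_apply_le n hz (x - M (M v))
  have h3 := hM.norm_approx_apply_le m hz (x - M (M v))
  have h4 : approx M n z x - approx M m z x = approx M n z (x - M (M v))
      - approx M m z (x - M (M v)) + (approx M n z (M (M v)) - approx M m z (M (M v))) := by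
    simp only [map_sub]; abel
  rw [h4]
  refine (norm_add_le _ _).trans ?_
  linarith [norm_sub_le (approx M n z (x - M (M v))) (approx M m z (x - M (M v)))]

theorem Sectorial.exists_tendsto_approx (hM : Sectorial M) (hd : DenseRange M) :
    ∃ T : ℂ → X →L[ℂ] X, ∀ z ∈ cone, ∀ x, Tendsto (fun n => approx M n z x) atTop (𝓝 (T z x)) := by
  have h : ∀ z : ℂ, ∃ S : X →L[ℂ] X, z ∈ cone →
      ∀ x, Tendsto (fun n => approx M n z x) atTop (𝓝 (S x)) := by
    intro z
    by_cases hz : z ∈ cone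
    swap
    -- Outside the sector the limit operator is irrelevant and is set to zero.
    · exact ⟨0, fun h => absurd h hz⟩
    have hc : ∀ x, CauchySeq (fun n => approx M n z x) := by
      intro x
      rw [Metric.cauchySeq_iff]
      intro η hη
      obtain ⟨v, hv⟩ := exists_norm_sub_apply_apply_lt hd x (show 0 < η / 4 by linarith)
      have h1 : Tendsto (fun n => 2 * ‖z‖ * eps n * ‖v‖) atTop (𝓝 0) := by
        simpa using (tendsto_eps.const_mul (2 * ‖z‖)).mul_const ‖v‖
      obtain ⟨N, hN⟩ := eventually_atTop.1 (h1.eventually (gt_mem_nhds (show 0 < η / 4 by linarith)))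
      refine ⟨N, fun m hm n hn => ?_⟩
      rw [dist_eq_norm]
      have := hM.norm_approx_sub_approx_le n m hz x v
      linarith [hN m hm, hN n hn]
    choose f hf using fun x => cauchySeq_tendsto_of_complete (hc x)
    exact ⟨continuousLinearMapOfTendsto (fun n => approx M n z) (tendsto_pi_nhds.2 hf),
      fun _ x => hf x⟩
  choose T hT using h
  exact ⟨T, fun z hz x => hT z hz x⟩

theorem tendsto_yosida_apply (hM : Accretive M) (hd : DenseRange M) (w : X) :
    Tendsto (fun n => yosida M (eps n) (M w)) atTop (𝓝 w) := by
  rw [Metric.tendsto_nhds]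
  intro η hη
  obtain ⟨v, hv⟩ := exists_norm_sub_apply_lt hd w (show 0 < η / 4 by linarith)
  have h1 : Tendsto (fun n => 2 * eps n * ‖v‖) atTop (𝓝 0) := by
    simpa using (tendsto_eps.const_mul 2).mul_const ‖v‖
  filter_upwards [h1.eventually (gt_mem_nhds (show 0 < η / 4 by linarith))] with n hn
  have hp := eps_pos n
  have h2 := mul_norm_yosida_le hM hp (w - M v)
  have h3 := norm_yosida_apply_le hM hp v
  have h4 : ‖yosida M (eps n) w‖ ≤ ‖yosida M (eps n) (w - M v)‖ + ‖yosida M (eps n) (M v)‖ := by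
    rw [map_sub]
    exact norm_le_norm_sub_add _ _
  rw [dist_eq_norm, norm_yosida_apply_sub hM hp]
  nlinarith

/-- Split w = (w - Mv) + Mv, using the linear remainder bound on the first part and the quadratic
one on the second. After division by t the right-hand side can be made small uniformly in n. -/
theorem Sectorial.norm_approx_sub_add_le (hM : Sectorial M) (n : ℕ) {t : ℝ} (ht : 0 ≤ t)
    (w v : X) : ‖approx M n t (M w) - M w + (t : ℂ) • Semigroup.yosida M (eps n) (M w)‖
      ≤ 4 * t * ‖w - M v‖ + 4 * t ^ 2 * ‖v‖ := by
  have hP := hM.accretive_smul_yosida n (ofReal_mem_cone ht)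
  have hn : ‖(t : ℂ)‖ = t := by rw [Complex.norm_real, Real.norm_of_nonneg ht]
  have hJ := norm_yosida_apply_le hM.accretive (eps_pos n)
  have h1 := hP.norm_exp_neg_sub_add_le_two_mul (M (w - M v))
  have h2 := hP.norm_exp_neg_sub_add_le_sq (M (M v))
  have h3 : Semigroup.yosida M (eps n) (Semigroup.yosida M (eps n) (M (M v)))
      = Semigroup.yosida M (eps n) (M (Semigroup.yosida M (eps n) (M v))) := by
    congr 1
    exact (congrArg (fun L : X →L[ℂ] X => L (M v)) (commute_yosida M (eps n)).eq).symm
  simp only [smul_apply, map_smul, norm_smul, hn, h3] at h1 h2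
  have h4 : approx M n t (M w) - M w + (t : ℂ) • Semigroup.yosida M (eps n) (M w)
      = (approx M n t (M (w - M v)) - M (w - M v)
          + (t : ℂ) • Semigroup.yosida M (eps n) (M (w - M v)))
        + (approx M n t (M (M v)) - M (M v)
          + (t : ℂ) • Semigroup.yosida M (eps n) (M (M v))) := by
    simp only [map_sub, smul_sub]
    abel
  have h5 : t * ‖Semigroup.yosida M (eps n) (M (w - M v))‖ ≤ t * (2 * ‖w - M v‖) := by
    gcongr; exact hJ _
  have h6 : t * (t * ‖Semigroup.yosida M (eps n) (M (Semigroup.yosida M (eps n) (M v)))‖)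
      ≤ t * (t * (2 * (2 * ‖v‖))) := by
    gcongr
    exact (hJ _).trans (mul_le_mul_of_nonneg_left (hJ v) zero_le_two)
  rw [h4]
  refine (norm_add_le _ _).trans ((add_le_add h1 h2).trans ?_)
  linarith

/-! ### The limit semigroup on the sector. -/

section Limit

variable {T : ℂ → X →L[ℂ] X} (hM : Sectorial M)
  (hT : ∀ z ∈ cone, ∀ x, Tendsto (fun n => approx M n z x) atTop (𝓝 (T z x)))

include hT in
theorem limit_zero : T 0 = 1 := by
  ext x
  refine tendsto_nhds_unique (hT 0 zero_mem_cone x) ?_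
  simp [approx_zero]

include hT in
theorem apply_limit {z : ℂ} (hz : z ∈ cone) (x : X) : M (T z x) = T z (M x) := by
  refine tendsto_nhds_unique ((M.continuous.tendsto _).comp (hT z hz x)) ?_
  simpa only [Function.comp_def, apply_approx] using hT z hz (M x)

include hM hT

theorem norm_limit_apply_le {z : ℂ} (hz : z ∈ cone) (x : X) : ‖T z x‖ ≤ ‖x‖ :=
  le_of_tendsto' (hT z hz x).norm fun n => hM.norm_approx_apply_le n hz x

theorem norm_limit_le {z : ℂ} (hz : z ∈ cone) : ‖T z‖ ≤ 1 :=
  ContinuousLinearMap.opNorm_le_bound _ zero_le_one fun x => by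
    simpa using norm_limit_apply_le hM hT hz x

/-- Contractivity uniform in n allows the limit to be taken inside the composition. -/
theorem limit_add {z w : ℂ} (hz : z ∈ cone) (hw : w ∈ cone) : T (z + w) = (T z).comp (T w) := by
  ext x
  refine tendsto_nhds_unique (hT _ (add_mem_cone hz hw) x) ?_
  simp only [approx_add, ContinuousLinearMap.comp_apply]
  have h1 : Tendsto (fun n => approx M n z (approx M n w x - T w x)) atTop (𝓝 0) := by
    refine squeeze_zero_norm (fun n => hM.norm_approx_apply_le n hz _) ?_
    simpa using ((hT w hw x).sub_const (T w x)).norm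
  have h2 := h1.add (hT z hz (T w x))
  simpa using h2

theorem norm_approx_sub_limit_le (n : ℕ) {z : ℂ} (hz : z ∈ cone) (x v : X) :
    ‖approx M n z x - T z x‖ ≤ 2 * ‖x - M (M v)‖ + 2 * ‖z‖ * eps n * ‖v‖ := by
  refine le_of_tendsto_of_tendsto' ((hT z hz x).const_sub _).norm ?_
    fun m => hM.norm_approx_sub_approx_le m n hz x v
  have := (((tendsto_eps.const_add (eps n)).const_mul (2 * ‖z‖)).mul_const ‖v‖).const_add
    (2 * ‖x - M (M v)‖)
  simpa using this

theorem norm_limit_sub_self_le {z : ℂ} (hz : z ∈ cone) (x v : X) :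
    ‖T z x - x‖ ≤ 2 * ‖x - M v‖ + 2 * ‖z‖ * ‖v‖ := by
  refine le_of_tendsto' ((hT z hz x).sub_const _).norm fun n => ?_
  have h1 := (hM.accretive_smul_yosida n hz).norm_exp_neg_sub_self_le (M v)
  rw [smul_apply, norm_smul] at h1
  have h2 := norm_yosida_apply_le hM.accretive (eps_pos n) v
  have h3 := mul_le_mul_of_nonneg_left h2 (norm_nonneg z)
  have h4 := hM.norm_approx_apply_le n hz (x - M v)
  have h5 : approx M n z x - x = approx M n z (x - M v) - (x - M v)
      + (approx M n z (M v) - M v) := by simp only [map_sub]; abel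
  rw [h5]
  refine (norm_add_le _ _).trans ?_
  have h6 : ‖approx M n z (M v) - M v‖ ≤ ‖z‖ * (2 * ‖v‖) := h1.trans h3
  linarith [norm_sub_le (approx M n z (x - M v)) (x - M v)]

theorem norm_limit_sub_add_le (hd : DenseRange M) {t : ℝ} (ht : 0 ≤ t) (w v : X) :
    ‖T t (M w) - M w + (t : ℂ) • w‖ ≤ 4 * t * ‖w - M v‖ + 4 * t ^ 2 * ‖v‖ :=
  le_of_tendsto' (((hT _ (ofReal_mem_cone ht) (M w)).sub_const (M w)).add
    ((tendsto_yosida_apply hM.accretive hd w).const_smul (t : ℂ))).norm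
    fun n => hM.norm_approx_sub_add_le n ht w v

theorem tendsto_limit_apply (hd : DenseRange M) (x : X) :
    Tendsto (fun z => T z x) (𝓝[cone] 0) (𝓝 x) := by
  rw [Metric.tendsto_nhds]
  intro η hη
  obtain ⟨v, hv⟩ := exists_norm_sub_apply_lt hd x (show 0 < η / 4 by linarith)
  have h1 : Tendsto (fun z : ℂ => 2 * ‖z‖ * ‖v‖) (𝓝[cone] 0) (𝓝 0) := by
    have : Continuous (fun z : ℂ => 2 * ‖z‖ * ‖v‖) := by fun_prop
    simpa using (this.tendsto 0).mono_left nhdsWithin_le_nhds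
  filter_upwards [h1.eventually (gt_mem_nhds (show 0 < η / 4 by linarith)), self_mem_nhdsWithin]
    with z hz hzc
  rw [dist_eq_norm]
  linarith [norm_limit_sub_self_le hM hT hzc x v]

/-- The Cauchy estimate depends on z only through ‖z‖, so each orbit is a locally uniform limit of
entire functions. -/
theorem differentiableOn_limit (hd : DenseRange M) : DifferentiableOn ℂ T openCone := by
  refine differentiableOn_of_strong isOpen_openCone (fun x => ?_)
    fun z hz => norm_limit_le hM hT (openCone_subset_cone hz)
  have hu : TendstoLocallyUniformlyOn (fun n z => approx M n z x) (fun z => T z x) atTop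
      openCone := by
    rw [Metric.tendstoLocallyUniformlyOn_iff]
    intro η hη z hz
    refine ⟨openCone ∩ Metric.ball z 1, inter_mem self_mem_nhdsWithin
      (mem_nhdsWithin_of_mem_nhds (Metric.ball_mem_nhds z one_pos)), ?_⟩
    obtain ⟨v, hv⟩ := exists_norm_sub_apply_apply_lt hd x (show 0 < η / 4 by linarith)
    have h1 : Tendsto (fun n => 2 * (‖z‖ + 1) * eps n * ‖v‖) atTop (𝓝 0) := by
      simpa using (tendsto_eps.const_mul (2 * (‖z‖ + 1))).mul_const ‖v‖
    filter_upwards [h1.eventually (gt_mem_nhds (show 0 < η / 4 by linarith))] with n hn w hw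
    rw [dist_comm, dist_eq_norm]
    have h2 := norm_approx_sub_limit_le hM hT n (openCone_subset_cone hw.1) x v
    have h3 : ‖w‖ ≤ ‖z‖ + 1 := by
      have := hw.2
      rw [Metric.mem_ball, dist_eq_norm] at this
      linarith [norm_sub_norm_le w z]
    have h4 : 2 * ‖w‖ * eps n * ‖v‖ ≤ 2 * (‖z‖ + 1) * eps n * ‖v‖ := by
      have := (eps_pos n).le
      gcongr
    linarith
  exact hu.differentiableOn
    (Eventually.of_forall fun n => (differentiable_approx M n x).differentiableOn) isOpen_openCone

end Limit

end Sectorial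

/-! ### Strong continuity and identification of the generator. -/

section Generation

variable {X : Type*} [NormedAddCommGroup X] [InnerProductSpace ℂ X] [CompleteSpace X]
  {M : X →L[ℂ] X} {T : ℂ → X →L[ℂ] X} (hM : Sectorial M) (hd : DenseRange M)
  (hT : ∀ z ∈ cone, ∀ x, Tendsto (fun n => approx M n z x) atTop (𝓝 (T z x)))

include hM hd hT

theorem continuousOn_limit (x : X) : ContinuousOn (fun t : ℝ => T t x) (Set.Ici 0) := by
  -- The semigroup law and contractivity reduce continuity at any time to continuity at 0, from
  -- either side.
  have hle : ∀ s t : ℝ, 0 ≤ s → s ≤ t → ‖T t x - T s x‖ ≤ ‖T ((|t - s| : ℝ) : ℂ) x - x‖ := by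
    intro s t hs hst
    have hts := sub_nonneg.2 hst
    have h : T t x = T s (T ((t - s : ℝ) : ℂ) x) := by
      rw [← ContinuousLinearMap.comp_apply, ← limit_add hM hT (ofReal_mem_cone hs)
        (ofReal_mem_cone hts)]
      congr 2
      push_cast
      ring
    rw [h, ← map_sub, abs_of_nonneg hts]
    exact norm_limit_apply_le hM hT (ofReal_mem_cone hs) _
  intro s hs
  rw [ContinuousWithinAt, tendsto_iff_norm_sub_tendsto_zero]
  refine squeeze_zero' (Eventually.of_forall fun _ => norm_nonneg _)
    (g := fun t => ‖T ((|t - s| : ℝ) : ℂ) x - x‖) ?_ ?_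
  · filter_upwards [self_mem_nhdsWithin] with t ht
    rcases le_total s t with h | h
    · exact hle s t hs h
    · rw [norm_sub_rev, abs_sub_comm]
      exact hle t s ht h
  · have h1 : Tendsto (fun t : ℝ => ((|t - s| : ℝ) : ℂ)) (𝓝[Set.Ici 0] s) (𝓝[cone] 0) := by
      refine tendsto_nhdsWithin_iff.2 ⟨?_, Eventually.of_forall fun t =>
        ofReal_mem_cone (abs_nonneg _)⟩
      have : Continuous (fun t : ℝ => ((|t - s| : ℝ) : ℂ)) := by fun_prop
      simpa using (this.tendsto s).mono_left nhdsWithin_le_nhds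
    have h2 := (((tendsto_limit_apply hM hT hd x).comp h1).sub_const x).norm
    simpa [Function.comp_def] using h2

theorem tendsto_limit_quotient (w : X) :
    Tendsto (fun t : ℝ => ((t : ℂ)⁻¹) • (T t (M w) - M w)) (𝓝[>] (0 : ℝ)) (𝓝 (-w)) := by
  rw [Metric.tendsto_nhds]
  intro η hη
  obtain ⟨v, hv⟩ := exists_norm_sub_apply_lt hd w (show 0 < η / 8 by linarith)
  have h1 : Tendsto (fun t : ℝ => 4 * t * ‖v‖) (𝓝[>] 0) (𝓝 0) := by
    have : Continuous (fun t : ℝ => 4 * t * ‖v‖) := by fun_prop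
    simpa using (this.tendsto 0).mono_left nhdsWithin_le_nhds
  filter_upwards [h1.eventually (gt_mem_nhds (show 0 < η / 4 by linarith)), self_mem_nhdsWithin]
    with t ht ht0
  have ht0 : 0 < t := ht0
  have htc : (t : ℂ) ≠ 0 := Complex.ofReal_ne_zero.2 ht0.ne'
  have h2 := norm_limit_sub_add_le hM hT hd ht0.le w v
  have h3 : ((t : ℂ)⁻¹) • (T t (M w) - M w) - -w
      = ((t : ℂ)⁻¹) • (T t (M w) - M w + (t : ℂ) • w) := by
    rw [smul_add, inv_smul_smul₀ htc, sub_neg_eq_add]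
  rw [dist_eq_norm, h3, norm_smul, norm_inv, Complex.norm_real, Real.norm_of_nonneg ht0.le,
    inv_mul_lt_iff₀ ht0]
  nlinarith

/-- If the quotients at x converge to y, applying M gives the quotients at M x, whose limit is both
M y and -x. -/
theorem tendsto_limit_quotient_iff (x y : X) :
    Tendsto (fun t : ℝ => ((t : ℂ)⁻¹) • (T t x - x)) (𝓝[>] (0 : ℝ)) (𝓝 y) ↔ x = M (-y) := by
  constructor
  · intro h
    have h1 := (M.continuous.tendsto y).comp h
    have h2 := tendsto_limit_quotient hM hd hT x
    have h3 : Tendsto (fun t : ℝ => ((t : ℂ)⁻¹) • (T t (M x) - M x)) (𝓝[>] (0 : ℝ))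
        (𝓝 (M y)) := by
      refine h1.congr' ?_
      filter_upwards [self_mem_nhdsWithin] with t ht
      rw [Function.comp_apply, map_smul, map_sub,
        apply_limit hT (ofReal_mem_cone (le_of_lt (Set.mem_Ioi.1 ht)))]
    rw [map_neg, ← tendsto_nhds_unique h2 h3, neg_neg]
  · rintro hx
    have := tendsto_limit_quotient hM hd hT (-y)
    rwa [← hx, neg_neg] at this

omit hM hd hT [CompleteSpace X] in
-- Product rule at t = 0: the factor e^{κt} adds κx to the derivative.
theorem tendsto_rescaled_quotient_iff {T : ℝ → X →L[ℂ] X} (κ : ℝ) (x y : X)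
    (hT : Tendsto (fun t : ℝ => T t x) (𝓝[>] 0) (𝓝 x)) :
    Tendsto (fun t : ℝ => ((t : ℂ)⁻¹) • ((Complex.exp (κ * t) • T t) x - x)) (𝓝[>] (0 : ℝ)) (𝓝 y) ↔
    Tendsto (fun t : ℝ => ((t : ℂ)⁻¹) • (T t x - x)) (𝓝[>] (0 : ℝ)) (𝓝 (y - (κ : ℂ) • x)) := by
  have hexp : Tendsto (fun t : ℝ => ((t : ℂ)⁻¹) * (Complex.exp (κ * t) - 1)) (𝓝[>] (0 : ℝ))
      (𝓝 (κ : ℂ)) := by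
    have h1 : HasDerivAt (fun t : ℝ => Complex.exp (κ * t)) (κ : ℂ) 0 := by
      have := (((hasDerivAt_id (0 : ℂ)).const_mul (κ : ℂ)).cexp).comp_ofReal (z := 0)
      simpa using this
    have h2 := (hasDerivAt_iff_tendsto_slope_zero.1 h1).mono_left
      (nhdsWithin_mono (0 : ℝ) (t := {0}ᶜ) (s := Set.Ioi 0) fun t ht => ne_of_gt ht)
    simpa using h2
  have hlim := hexp.smul hT
  have heq : ∀ t : ℝ, ((t : ℂ)⁻¹) • ((Complex.exp (κ * t) • T t) x - x)
      = (((t : ℂ)⁻¹) * (Complex.exp (κ * t) - 1)) • T t x + ((t : ℂ)⁻¹) • (T t x - x) := by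
    intro t
    rw [smul_apply]
    module
  simp only [heq]
  constructor
  · intro h
    simpa using h.sub hlim
  · intro h
    simpa using hlim.add h

omit hT in
/-- If `M` is a sectorial bounded operator with dense range, then `x ↦ κ x - M⁻¹ x` generates a
holomorphic `C₀`-semigroup. -/
theorem generatesHolomorphicC0Semigroup (A : X →ₗ.[ℂ] X) (κ : ℝ)
    (hA : ∀ x y : X, (x, y) ∈ A.graph ↔ x = M ((κ : ℂ) • x - y)) :
    GeneratesHolomorphicC0Semigroup A := by
  obtain ⟨T, hT⟩ := hM.exists_tendsto_approx hd
  refine ⟨fun t => Complex.exp (κ * t) • T t, ⟨?_, ?_, ?_⟩, ?_, ?_⟩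
  · simp [limit_zero hT]
    rfl
  · intro s t hs ht
    have : ((s + t : ℝ) : ℂ) = s + t := by push_cast; rfl
    simp only [this]
    rw [limit_add hM hT (ofReal_mem_cone hs) (ofReal_mem_cone ht), mul_add, Complex.exp_add]
    ext x
    simp [smul_smul, mul_comm]
  · intro x
    have h1 : Continuous (fun t : ℝ => Complex.exp (κ * t)) := by fun_prop
    exact h1.continuousOn.smul (continuousOn_limit hM hd hT x)
  · refine ⟨Real.pi / 4, by positivity, by linarith [Real.pi_pos],
      fun z => Complex.exp (κ * z) • T z, ?_, fun t _ => rfl, ?_⟩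
    · have h1 : Differentiable ℂ (fun z : ℂ => Complex.exp (κ * z)) := by fun_prop
      exact h1.differentiableOn.smul
        ((differentiableOn_limit hM hT hd).mono sector_pi_div_four_subset)
    · intro θ' _ hθ'
      refine ⟨Real.exp |κ|, fun z hz hz1 => ?_⟩
      have hzc : z ∈ cone := openCone_subset_cone
        (sector_pi_div_four_subset ⟨hz.1, hz.2.trans hθ'⟩)
      have h1 := norm_limit_le hM hT hzc
      have h2 : ‖Complex.exp (κ * z)‖ ≤ Real.exp |κ| := by
        rw [Complex.norm_exp]
        refine Real.exp_le_exp.2 ((Complex.re_le_norm _).trans ?_)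
        rw [norm_mul, Complex.norm_real, Real.norm_eq_abs]
        exact mul_le_of_le_one_right (abs_nonneg _) hz1
      rw [norm_smul]
      exact (mul_le_mul h2 h1 (norm_nonneg _) (Real.exp_nonneg _)).trans_eq (mul_one _)
  · intro x y
    have hx : Tendsto (fun t : ℝ => T t x) (𝓝[>] 0) (𝓝 x) := by
      have := (continuousOn_limit hM hd hT x 0 Set.self_mem_Ici).mono_left
        (nhdsWithin_mono (0 : ℝ) Set.Ioi_subset_Ici_self)
      simpa [limit_zero hT] using this
    rw [hA, tendsto_rescaled_quotient_iff (T := fun t : ℝ => T t) κ x y hx,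
      tendsto_limit_quotient_iff hM hd hT, neg_sub]

end Generation

/-! ### Bounded perturbations of the operator associated with a Hilbert space embedding -/

section Embedding

variable {V H : Type*} [NormedAddCommGroup V] [InnerProductSpace ℂ V] [CompleteSpace V]
  [NormedAddCommGroup H] [InnerProductSpace ℂ H] [CompleteSpace H]

open ContinuousLinearMap (adjoint)

theorem inner_self_eq_ofReal_norm_sq {F : Type*} [NormedAddCommGroup F] [InnerProductSpace ℂ F]
    (w : F) : inner ℂ w w = ((‖w‖ ^ 2 : ℝ) : ℂ) := by
  rw [inner_self_eq_norm_sq_to_K]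
  simp

/-- Let `ι : V → H` be a contractive embedding of Hilbert spaces and `B` bounded on `H`. The
operator in `V` associated with the form `⟪v, x⟫ + ⟪ι v, (B - 1) ι x⟫` and the inner product of `H`
is the negative of the generator of a holomorphic `C₀`-semigroup. -/
theorem exists_generator_of_embedding (ι : V →L[ℂ] H) (hι : Function.Injective ι)
    (hι1 : ‖ι‖ ≤ 1) (B : H →L[ℂ] H) :
    ∃ A : V →ₗ.[ℂ] V, GeneratesHolomorphicC0Semigroup A ∧
      ∀ x y : V, (x, y) ∈ A.graph ↔
        ∀ v, inner ℂ v x = inner ℂ (ι v) (ι x - B (ι x) - ι y) := by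
  -- The 1 compensates the -1 in the form, ‖B‖ makes E = κ - 1 + B accretive, and ‖B‖² absorbs the
  -- cross term in the sector estimate.
  set κ : ℝ := 1 + ‖B‖ + ‖B‖ ^ 2 with hκ
  have hB0 := norm_nonneg B
  have hιle : ∀ x, ‖ι x‖ ≤ ‖x‖ := fun x => by simpa using ι.le_of_opNorm_le hι1 x
  set E : H →L[ℂ] H := ((κ - 1 : ℝ) : ℂ) • 1 + B with hE
  have hEapp : ∀ w, E w = ((κ - 1 : ℝ) : ℂ) • w + B w := fun w => rfl
  have hacc : Accretive ((adjoint ι).comp (E.comp ι)) := by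
    intro x
    rw [ContinuousLinearMap.comp_apply, ContinuousLinearMap.comp_apply,
      ContinuousLinearMap.adjoint_inner_left, hEapp, inner_add_left, inner_smul_left, inner_self_eq_ofReal_norm_sq,
      Complex.conj_ofReal, ← Complex.ofReal_mul, Complex.add_re, Complex.ofReal_re]
    have h1 : |(inner ℂ (B (ι x)) (ι x)).re| ≤ ‖B‖ * ‖ι x‖ ^ 2 := by
      refine (Complex.abs_re_le_norm _).trans ((norm_inner_le_norm _ _).trans ?_)
      nlinarith [B.le_opNorm (ι x), norm_nonneg (ι x)]
    have h2 : 0 ≤ ‖B‖ ^ 2 * ‖ι x‖ ^ 2 := by positivity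
    have h3 := neg_abs_le (inner ℂ (B (ι x)) (ι x)).re
    rw [hκ]
    linarith
  have hU := hacc.isUnit_add_smul_one one_pos
  set Q := (adjoint ι).comp (E.comp ι) + ((1 : ℝ) : ℂ) • (1 : V →L[ℂ] V) with hQ
  set K : V →L[ℂ] V := (adjoint ι).comp ι with hK
  -- This is the resolvent (κ - A)⁻¹: Q represents the shifted form on V, and K the inner product of
  -- H.
  set M : V →L[ℂ] V := Ring.inverse Q * K with hM
  have hQi : ∀ x, Q (Ring.inverse Q x) = x := fun x =>
    congrArg (fun L : V →L[ℂ] V => L x) (Ring.mul_inverse_cancel _ hU)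
  have hiQ : ∀ x, Ring.inverse Q (Q x) = x := fun x =>
    congrArg (fun L : V →L[ℂ] V => L x) (Ring.inverse_mul_cancel _ hU)
  have hQapp : ∀ x, Q x = adjoint ι (E (ι x)) + x := fun x => by simp [hQ]
  have hMiff : ∀ x g, x = M g ↔ x = adjoint ι (ι g - E (ι x)) := by
    intro x g
    have h1 : x = M g ↔ Q x = K g := by
      constructor
      · rintro h
        rw [h]
        exact hQi _
      · intro h
        rw [← hiQ x, h]
        rfl
    rw [h1, hQapp, map_sub, eq_sub_iff_add_eq, add_comm x]
    rfl
  have hKinj : ∀ x, (inner ℂ (K x) x : ℂ) = 0 → x = 0 := by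
    intro x hx
    rw [hK, ContinuousLinearMap.comp_apply, ContinuousLinearMap.adjoint_inner_left,
      inner_self_eq_zero] at hx
    exact hι (by rw [hx, map_zero])
  have hMinj : ∀ g, M g = 0 → g = 0 := by
    intro g hg
    apply hKinj
    have : K g = Q (M g) := (hQi _).symm
    rw [this, hg, map_zero, inner_zero_left]
  have hdense : DenseRange M := by
    have hKd : DenseRange K := by
      have h1 : (LinearMap.range K.toLinearMap).topologicalClosure = ⊤ := by
        -- A vector x orthogonal to the range of K satisfies 0 = ⟪Kx, x⟫ = ‖ιx‖², so x = 0.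
        rw [Submodule.topologicalClosure_eq_top_iff, Submodule.eq_bot_iff]
        intro x hx
        exact hKinj x (hx (K x) ⟨x, rfl⟩)
      have h2 := Submodule.dense_iff_topologicalClosure_eq_top.2 h1
      exact h2
    have hs : Function.Surjective (Ring.inverse Q : V →L[ℂ] V) := fun x => ⟨Q x, hiQ x⟩
    exact hs.denseRange.comp hKd (Ring.inverse Q : V →L[ℂ] V).continuous
  have hsect : Sectorial M := by
    intro g
    set x := M g with hx
    set w := ι g - E (ι x) with hw
    have hxw : x = adjoint ι w := (hMiff x g).1 hx
    have hg : ι g = w + (((κ - 1 : ℝ) : ℂ) • ι x + B (ι x)) := by rw [hw, ← hEapp]; abel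
    -- The relation x = ι*w turns ⟪x, g⟫ into ⟪w, ιg⟫ and ⟪w, ιx⟫ into ‖x‖², which makes the leading
    -- terms real.
    have h1 : inner ℂ x g = ((‖w‖ ^ 2 + (κ - 1) * ‖x‖ ^ 2 : ℝ) : ℂ) + inner ℂ w (B (ι x)) := by
      have h2 : inner ℂ w (ι x) = ((‖x‖ ^ 2 : ℝ) : ℂ) := by
        rw [← ContinuousLinearMap.adjoint_inner_left, ← hxw, inner_self_eq_ofReal_norm_sq]
      nth_rewrite 1 [hxw]
      rw [ContinuousLinearMap.adjoint_inner_left, hg, inner_add_right, inner_add_right,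
        inner_smul_right, h2, inner_self_eq_ofReal_norm_sq]
      push_cast
      ring
    have h3 : ‖inner ℂ w (B (ι x))‖ ≤ ‖w‖ * (‖B‖ * ‖x‖) :=
      (norm_inner_le_norm _ _).trans (mul_le_mul_of_nonneg_left
        ((B.le_opNorm _).trans (mul_le_mul_of_nonneg_left (hιle x) hB0)) (norm_nonneg _))
    have h4 := (Complex.abs_im_le_norm _).trans h3
    have h5 := (neg_le_of_abs_le ((Complex.abs_re_le_norm _).trans h3))
    rw [h1, Complex.add_re, Complex.add_im, Complex.ofReal_re, Complex.ofReal_im, zero_add]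
    have h6 : 0 ≤ ‖B‖ * ‖x‖ ^ 2 := by positivity
    have h7 : (κ - 1) * ‖x‖ ^ 2 = ‖B‖ * ‖x‖ ^ 2 + (‖B‖ * ‖x‖) ^ 2 := by rw [hκ]; ring
    -- The cross term counts twice, for real and imaginary part: 2‖w‖‖B‖‖x‖ ≤ ‖w‖² + ‖B‖²‖x‖².
    nlinarith [sq_nonneg (‖w‖ - ‖B‖ * ‖x‖)]
  -- The kernel of f is the graph of A; injectivity of M makes it single-valued.
  let f : V × V →ₗ[ℂ] V := LinearMap.fst ℂ V V -
    M.toLinearMap ∘ₗ ((κ : ℂ) • LinearMap.fst ℂ V V - LinearMap.snd ℂ V V)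
  have hf : ∀ x y, (x, y) ∈ LinearMap.ker f ↔ x = M ((κ : ℂ) • x - y) := by
    intro x y
    rw [LinearMap.mem_ker, ← sub_eq_zero (b := M _)]
    rfl
  have hgraph : ∀ x y, (x, y) ∈ (LinearMap.ker f).toLinearPMap.graph ↔
      x = M ((κ : ℂ) • x - y) := by
    intro x y
    rw [Submodule.toLinearPMap_graph_eq, hf]
    rintro ⟨a, b⟩ hab rfl
    rw [hf, smul_zero, zero_sub, map_neg, eq_comm, neg_eq_zero] at hab
    exact hMinj b hab
  refine ⟨_, generatesHolomorphicC0Semigroup hsect hdense _ κ hgraph, fun x y => ?_⟩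
  have h1 : ι ((κ : ℂ) • x - y) - E (ι x) = ι x - B (ι x) - ι y := by
    rw [map_sub, map_smul, hEapp]
    push_cast
    module
  rw [hgraph, hMiff, h1]
  simp only [← ContinuousLinearMap.adjoint_inner_right]
  exact ⟨fun h v => congrArg (inner ℂ v) h, fun h => ext_inner_left ℂ h⟩

end Embedding

end Semigroup

namespace Wentzell

noncomputable section

variable {d : ℕ} {Ω : Set (EuclideanSpace ℝ (Fin d))}

/-! ### Continuity of the L² pairings. -/

theorem integral_mul_eq_inner {α : Type*} [MeasurableSpace α] {μ : Measure α} (u : Lp ℂ 2 μ)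
    {η : α → ℂ} (hη : MemLp η 2 μ) : ∫ x, u x * η x ∂μ = inner ℂ hη.star.toLp u := by
  rw [L2.inner_def]
  apply integral_congr_ae
  filter_upwards [hη.star.coeFn_toLp] with x hx
  rw [hx]
  simp

theorem continuous_integral_mul {α : Type*} [MeasurableSpace α] {μ : Measure α}
    {η : α → ℂ} (hη : MemLp η 2 μ) : Continuous (fun u : Lp ℂ 2 μ => ∫ x, u x * η x ∂μ) := by
  simp only [integral_mul_eq_inner _ hη]
  fun_prop

/-- The `i`-th coordinate on `ℂᵈ`. -/
abbrev coordProj (i : Fin d) : EuclideanSpace ℂ (Fin d) →L[ℂ] ℂ := EuclideanSpace.proj i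

theorem continuous_integral_coord_mul (i : Fin d) {η : EuclideanSpace ℝ (Fin d) → ℂ}
    (hη : MemLp η 2 (volume.restrict Ω)) :
    Continuous (fun g : L2Vec Ω => ∫ x in Ω, g x i * η x) := by
  have h : ∀ g : L2Vec Ω, ∫ x in Ω, g x i * η x
      = ∫ x in Ω, ((coordProj i).compLpL 2
        (volume.restrict Ω) g) x * η x := by
    intro g
    apply integral_congr_ae
    filter_upwards [(coordProj i).coeFn_compLpL g]
      with x hx
    rw [hx]
    rfl
  simp only [h]
  exact (continuous_integral_mul hη).comp (ContinuousLinearMap.continuous _)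

/-! ### Test functions -/

theorem IsTestFunction.star {η : EuclideanSpace ℝ (Fin d) → ℂ} (hη : IsTestFunction Ω η) :
    IsTestFunction Ω (fun x => starRingEnd ℂ (η x)) where
  contDiff := Complex.conjCLE.contDiff.comp hη.contDiff
  hasCompactSupport := hη.hasCompactSupport.comp_left (map_zero _)
  tsupport_subset := (closure_mono (Function.support_comp_subset (map_zero _) η)).trans
    hη.tsupport_subset

theorem IsTestFunction.partialDeriv_star {η : EuclideanSpace ℝ (Fin d) → ℂ}
    (hη : IsTestFunction Ω η) (i : Fin d) (x : EuclideanSpace ℝ (Fin d)) :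
    partialDeriv i (fun x => starRingEnd ℂ (η x)) x = starRingEnd ℂ (partialDeriv i η x) := by
  have h := (Complex.conjCLE.toContinuousLinearMap.hasFDerivAt (x := η x)).comp x
    ((hη.contDiff.differentiable (by simp)) x).hasFDerivAt
  exact congrArg (fun L : EuclideanSpace ℝ (Fin d) →L[ℝ] ℂ => L (EuclideanSpace.single i 1))
    h.fderiv

theorem IsTestFunction.partialDeriv {η : EuclideanSpace ℝ (Fin d) → ℂ}
    (hη : IsTestFunction Ω η) (i : Fin d) : IsTestFunction Ω (partialDeriv i η) where
  contDiff := (hη.contDiff.fderiv_right (m := ∞) (by simp)).clm_apply contDiff_const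
  hasCompactSupport := hη.hasCompactSupport.fderiv_apply ℝ _
  tsupport_subset := (tsupport_fderiv_apply_subset ℝ _).trans hη.tsupport_subset

theorem IsTestFunction.eq_zero {η : EuclideanSpace ℝ (Fin d) → ℂ} (hη : IsTestFunction Ω η)
    {x : EuclideanSpace ℝ (Fin d)} (hx : x ∉ Ω) : η x = 0 :=
  image_eq_zero_of_notMem_tsupport fun h => hx (hη.tsupport_subset h)

theorem laplacian_eq_sum {η : EuclideanSpace ℝ (Fin d) → ℂ} (hη : IsTestFunction Ω η)
    (x : EuclideanSpace ℝ (Fin d)) :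
    Laplacian.laplacian η x = ∑ i, partialDeriv i (partialDeriv i η) x := by
  rw [InnerProductSpace.laplacian_eq_iteratedFDeriv_orthonormalBasis η
    (EuclideanSpace.basisFun (Fin d) ℝ)]
  refine Finset.sum_congr rfl fun i _ => ?_
  have hd : DifferentiableAt ℝ (fderiv ℝ η) x :=
    (hη.contDiff.fderiv_right (m := ∞) (by simp)).differentiable (by simp) x
  have h := hd.hasFDerivAt.clm_apply (hasFDerivAt_const (EuclideanSpace.single i (1 : ℝ)) x)
  rw [iteratedFDeriv_two_apply]
  unfold partialDeriv
  rw [h.fderiv]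
  simp

theorem ae_eq_zero_of_forall_testFunction (hΩ : IsOpen Ω) {f : EuclideanSpace ℝ (Fin d) → ℂ}
    (hf : MemLp f 2 (volume.restrict Ω))
    (h : ∀ η, IsTestFunction Ω η → ∫ x in Ω, f x * η x = 0) : f =ᵐ[volume.restrict Ω] 0 := by
  have hloc : LocallyIntegrableOn f Ω volume :=
    locallyIntegrableOn_of_locallyIntegrable_restrict (hf.locallyIntegrable (by norm_num))
  have := hΩ.ae_eq_zero_of_integral_contDiff_smul_eq_zero hloc fun g hg hgc hgs => by
    have hη : IsTestFunction Ω (fun x => (g x : ℂ)) :=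
      ⟨Complex.ofRealCLM.contDiff.comp hg, hgc.comp_left Complex.ofReal_zero,
        (closure_mono (Function.support_comp_subset Complex.ofReal_zero g)).trans hgs⟩
    have h1 := h _ hη
    rw [setIntegral_eq_integral_of_forall_compl_eq_zero fun x hx => by
      rw [hη.eq_zero hx, mul_zero]] at h1
    rw [← h1]
    congr 1
    ext x
    rw [Complex.real_smul, mul_comm]
  exact (ae_restrict_iff' hΩ.measurableSet).2 this

theorem ae_eq_of_forall_testFunction (hΩ : IsOpen Ω) {f g : EuclideanSpace ℝ (Fin d) → ℂ}
    (hf : MemLp f 2 (volume.restrict Ω)) (hg : MemLp g 2 (volume.restrict Ω))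
    (h : ∀ η, IsTestFunction Ω η → ∫ x in Ω, f x * η x = ∫ x in Ω, g x * η x) :
    f =ᵐ[volume.restrict Ω] g := by
  have h0 := ae_eq_zero_of_forall_testFunction hΩ (hf.sub hg) fun η hη => by
    have := integral_sub (hf.integrable_mul hη.memLp) (hg.integrable_mul hη.memLp)
    simp only [Pi.mul_apply] at this
    rw [h η hη, sub_self] at this
    simpa only [Pi.sub_apply, sub_mul] using this
  filter_upwards [h0] with x hx
  exact sub_eq_zero.1 hx

theorem IsWeakGradient.unique (hΩ : IsOpen Ω) {u : L2Dom Ω} {g g' : L2Vec Ω}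
    (h : IsWeakGradient u g) (h' : IsWeakGradient u g') : g = g' := by
  have hi : ∀ i, (fun x => g x i) =ᵐ[volume.restrict Ω] fun x => g' x i := fun i =>
    ae_eq_of_forall_testFunction hΩ (memLp_coord g i) (memLp_coord g' i) fun η hη =>
      neg_injective ((h η hη i).symm.trans (h' η hη i))
  refine Lp.ext ?_
  filter_upwards [ae_all_iff.2 hi] with x hx
  ext i
  exact hx i

theorem HasWeakLaplacian.unique (hΩ : IsOpen Ω) {u f f' : L2Dom Ω}
    (h : HasWeakLaplacian u f) (h' : HasWeakLaplacian u f') : f = f' :=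
  Lp.ext (ae_eq_of_forall_testFunction hΩ (Lp.memLp f) (Lp.memLp f') fun η hη =>
    (h η hη).symm.trans (h' η hη))

/-- The stored gradient is determined by the function, as weak gradients on an open set are unique.
This underlies injectivity of V → L²(Ω) ⊕ L²(Γ). -/
theorem H1.fn_injective (hΩ : IsOpen Ω) {u v : H1 Ω} (h : u.fn = v.fn) : u = v := by
  have hg : u.grad = v.grad := IsWeakGradient.unique hΩ (u := u.fn) u.2 (by rw [h]; exact v.2)
  apply Subtype.ext
  exact WithLp.ofLp_injective 2 (Prod.ext h hg)

/-- The gradient of a test function is its weak gradient. -/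
theorem IsTestFunction.exists_H1 {η : EuclideanSpace ℝ (Fin d) → ℂ}
    (hη : IsTestFunction Ω η) :
    ∃ w : H1 Ω, w.fn =ᵐ[volume.restrict Ω] η ∧
      ∀ i, (fun x => w.grad x i) =ᵐ[volume.restrict Ω] Wentzell.partialDeriv i η := by
  have hg : MemLp (fun x => WithLp.toLp 2 (fun i => Wentzell.partialDeriv i η x) :
      EuclideanSpace ℝ (Fin d) → EuclideanSpace ℂ (Fin d)) 2 (volume.restrict Ω) := by
    have hi : ∀ i, MemLp (fun x => WithLp.ofLp (WithLp.toLp 2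
        (fun i => Wentzell.partialDeriv i η x) : EuclideanSpace ℂ (Fin d)) i) 2
        (volume.restrict Ω) := hη.memLp_partialDeriv
    exact MemLp.of_eval_piLp hi
  have hgi : ∀ i, (fun x => hg.toLp _ x i) =ᵐ[volume.restrict Ω] Wentzell.partialDeriv i η := by
    intro i
    filter_upwards [hg.coeFn_toLp] with x hx
    rw [hx]
  refine ⟨⟨WithLp.toLp 2 (hη.memLp.toLp _, hg.toLp _), ?_⟩, hη.memLp.coeFn_toLp, hgi⟩
  intro ζ hζ i
  change ∫ x in Ω, hη.memLp.toLp _ x * _ = - ∫ x in Ω, hg.toLp _ x i * _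
  have e1 : ∫ x in Ω, hη.memLp.toLp _ x * Wentzell.partialDeriv i ζ x
      = ∫ x, η x * Wentzell.partialDeriv i ζ x := by
    refine Eq.trans ?_ (setIntegral_eq_integral_of_forall_compl_eq_zero (s := Ω) fun x hx => by
      rw [hη.eq_zero hx, zero_mul])
    apply integral_congr_ae
    filter_upwards [hη.memLp.coeFn_toLp] with x hx
    rw [hx]
  have e2 : ∫ x in Ω, hg.toLp _ x i * ζ x = ∫ x, Wentzell.partialDeriv i η x * ζ x := by
    refine Eq.trans ?_ (setIntegral_eq_integral_of_forall_compl_eq_zero (s := Ω) fun x hx => by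
      rw [hζ.eq_zero hx, mul_zero])
    apply integral_congr_ae
    filter_upwards [hgi i] with x hx
    rw [hx]
  rw [e1, e2]
  have hint : ∀ {a b : EuclideanSpace ℝ (Fin d) → ℂ}, IsTestFunction Ω a → IsTestFunction Ω b →
      Integrable (fun x => a x * b x) := fun ha hb =>
    (ha.contDiff.continuous.mul hb.contDiff.continuous).integrable_of_hasCompactSupport
      ha.hasCompactSupport.mul_right
  -- Both integrands vanish off Ω, so integration by parts takes place on the whole space, without
  -- boundary terms.
  exact integral_mul_fderiv_eq_neg_fderiv_mul_of_integrable (hint (hη.partialDeriv i) hζ)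
    (hint hη (hζ.partialDeriv i)) (hint hη hζ)
    (fun x _ => hη.contDiff.differentiable (by simp) x)
    (fun x _ => hζ.contDiff.differentiable (by simp) x)

/-! ### Hilbert space structure of `H¹(Ω)` and `V` -/

instance : InnerProductSpace ℂ (H1 Ω) := Submodule.innerProductSpace (H1Submodule Ω)

theorem isClosed_H1Submodule :
    IsClosed (H1Submodule Ω : Set (WithLp 2 (L2Dom Ω × L2Vec Ω))) := by
  have h : (H1Submodule Ω : Set (WithLp 2 (L2Dom Ω × L2Vec Ω))) =
      ⋂ (η : EuclideanSpace ℝ (Fin d) → ℂ) (_ : IsTestFunction Ω η) (i : Fin d),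
        {p | ∫ x in Ω, p.fst x * partialDeriv i η x = -∫ x in Ω, p.snd x i * η x} := by
    ext p
    simp only [Set.mem_iInter]
    rfl
  rw [h]
  refine isClosed_iInter fun η => isClosed_iInter fun hη => isClosed_iInter fun i => ?_
  exact isClosed_eq
    ((continuous_integral_mul (hη.memLp_partialDeriv i)).comp (WithLp.continuous_fst ..))
    ((continuous_integral_coord_mul i hη.memLp).comp (WithLp.continuous_snd ..)).neg

instance : CompleteSpace (H1 Ω) := isClosed_H1Submodule.completeSpace_coe

/-- The pairs consisting of a function in `C(closure Ω) ∩ H¹(Ω)` and its restriction to the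
boundary. -/
def contPairs (Ω : Set (EuclideanSpace ℝ (Fin d))) : Set (WithLp 2 (H1 Ω × L2Bdry Ω)) :=
  {p | ∃ v, IsContH1 v p.fst ∧ p.snd =ᵐ[bdryMeasure Ω] v}

/-- Approximative traces are sequential limits of continuous pairs, so V is a closure: hence it is
complete, and continuous pairs suffice for testing. -/
theorem coe_VSubmodule : (VSubmodule Ω : Set (WithLp 2 (H1 Ω × L2Bdry Ω))) =
    closure (contPairs Ω) := by
  ext p
  rw [mem_closure_iff_seq_limit]
  constructor
  · rintro ⟨v, w, ψ, h1, h2, h3, h4⟩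
    refine ⟨fun n => WithLp.toLp 2 (w n, ψ n), fun n => ⟨v n, h1 n, h2 n⟩, ?_⟩
    exact ((WithLp.prod_continuous_toLp ..).tendsto _).comp (h3.prodMk_nhds h4)
  · rintro ⟨q, hq, hlim⟩
    choose v hv hv' using hq
    exact ⟨v, fun n => (q n).fst, fun n => (q n).snd, hv, hv',
      ((WithLp.continuous_fst ..).tendsto _).comp hlim,
      ((WithLp.continuous_snd ..).tendsto _).comp hlim⟩

instance : InnerProductSpace ℂ (V Ω) := Submodule.innerProductSpace (VSubmodule Ω)

instance : CompleteSpace (V Ω) :=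
  (coe_VSubmodule (Ω := Ω) ▸ isClosed_closure :
    IsClosed (VSubmodule Ω : Set (WithLp 2 (H1 Ω × L2Bdry Ω)))).completeSpace_coe

theorem V.inner_eq (x y : V Ω) : inner ℂ x y = inner ℂ x.fn.fn y.fn.fn +
    inner ℂ x.fn.grad y.fn.grad + inner ℂ x.bdry y.bdry := rfl

theorem V.norm_sq_eq (x : V Ω) : ‖x‖ ^ 2 = ‖x.fn.fn‖ ^ 2 + ‖x.fn.grad‖ ^ 2 + ‖x.bdry‖ ^ 2 := by
  have h1 : ‖x‖ ^ 2 = ‖x.fn‖ ^ 2 + ‖x.bdry‖ ^ 2 := WithLp.prod_norm_sq_eq_of_L2 x.1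
  have h2 : ‖x.fn‖ ^ 2 = ‖x.fn.fn‖ ^ 2 + ‖x.fn.grad‖ ^ 2 := WithLp.prod_norm_sq_eq_of_L2 x.fn.1
  rw [h1, h2]

theorem norm_sq_toLp_prod {E F : Type*} [SeminormedAddCommGroup E] [SeminormedAddCommGroup F]
    (a : E) (b : F) : ‖(WithLp.toLp 2 (a, b) : WithLp 2 (E × F))‖ ^ 2 = ‖a‖ ^ 2 + ‖b‖ ^ 2 :=
  WithLp.prod_norm_sq_eq_of_L2 _

theorem V.norm_toL2Sum_le (x : V Ω) : ‖x.toL2Sum‖ ≤ 1 * ‖x‖ := by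
  rw [one_mul]
  refine le_of_sq_le_sq ?_ (norm_nonneg _)
  rw [V.toL2Sum, norm_sq_toLp_prod, V.norm_sq_eq]
  linarith [sq_nonneg ‖x.fn.grad‖]

/-! ### The embedding into L²(Ω) ⊕ L²(Γ) and the weak equation. -/

/-- The embedding of `V` into `L²(Ω) ⊕ L²(Γ)`. -/
def embedding (Ω : Set (EuclideanSpace ℝ (Fin d))) : V Ω →L[ℂ] L2Sum Ω :=
  (WithLp.prodContinuousLinearEquiv 2 ℂ (L2Dom Ω) (L2Bdry Ω)).symm.toContinuousLinearMap.comp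
    ((((WithLp.fstL 2 ℂ (L2Dom Ω) (L2Vec Ω)).comp (H1Submodule Ω).subtypeL).comp
      ((WithLp.fstL 2 ℂ (H1 Ω) (L2Bdry Ω)).comp (VSubmodule Ω).subtypeL)).prod
      ((WithLp.sndL 2 ℂ (H1 Ω) (L2Bdry Ω)).comp (VSubmodule Ω).subtypeL))

theorem embedding_apply (x : V Ω) : embedding Ω x = x.toL2Sum := rfl

theorem norm_embedding_le : ‖embedding Ω‖ ≤ 1 :=
  ContinuousLinearMap.opNorm_le_bound _ zero_le_one V.norm_toL2Sum_le

theorem V.toL2Sum_fst (x : V Ω) : x.toL2Sum.fst = x.fn.fn := by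
  rw [V.toL2Sum, WithLp.toLp_fst]

theorem V.toL2Sum_snd (x : V Ω) : x.toL2Sum.snd = x.bdry := by
  rw [V.toL2Sum, WithLp.toLp_snd]

theorem embedding_injective (hΩ : IsOpen Ω) : Function.Injective (embedding Ω) := by
  intro x y h
  rw [embedding_apply, embedding_apply] at h
  have h1 : x.fn = y.fn := H1.fn_injective hΩ (by rw [← V.toL2Sum_fst, h, V.toL2Sum_fst])
  have h2 : x.bdry = y.bdry := by rw [← V.toL2Sum_snd, h, V.toL2Sum_snd]
  apply Subtype.ext
  exact WithLp.ofLp_injective 2 (Prod.ext h1 h2)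

/-- Multiplication by `β` on `L²(Γ)`. -/
def mulLinfty (β : LinftyBdry Ω) : L2Bdry Ω →L[ℂ] L2Bdry Ω :=
  LinearMap.mkContinuous
    { toFun := fun φ => (β • φ : L2Bdry Ω)
      map_add' := fun φ ψ => Lp.add_smul β φ ψ
      map_smul' := fun c φ => (Lp.smul_comm c β φ).symm } ‖β‖ (Lp.norm_smul_le β)

/-- The operator `(u, φ) ↦ (0, β φ)` on `L²(Ω) ⊕ L²(Γ)`. -/
def boundaryMul (β : LinftyBdry Ω) : L2Sum Ω →L[ℂ] L2Sum Ω :=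
  (WithLp.prodContinuousLinearEquiv 2 ℂ (L2Dom Ω) (L2Bdry Ω)).symm.toContinuousLinearMap.comp
    ((0 : L2Sum Ω →L[ℂ] L2Dom Ω).prod
      ((mulLinfty β).comp (WithLp.sndL 2 ℂ (L2Dom Ω) (L2Bdry Ω))))

theorem boundaryMul_apply (β : LinftyBdry Ω) (p : L2Sum Ω) :
    boundaryMul β p = WithLp.toLp 2 (0, (β • p.snd : L2Bdry Ω)) := rfl

theorem inner_toLp_prod {E F : Type*} [NormedAddCommGroup E] [InnerProductSpace ℂ E]
    [NormedAddCommGroup F] [InnerProductSpace ℂ F] (a a' : E) (b b' : F) :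
    inner ℂ (WithLp.toLp 2 (a, b) : WithLp 2 (E × F)) (WithLp.toLp 2 (a', b'))
      = inner ℂ a a' + inner ℂ b b' := rfl

/-- The weak form of the equation `Δ^W x = y`, tested with a pair `p`. -/
def WeakEq (β : LinftyBdry Ω) (x y : V Ω) (p : WithLp 2 (H1 Ω × L2Bdry Ω)) : Prop :=
  inner ℂ p.fst.grad x.fn.grad
    = -inner ℂ p.fst.fn y.fn.fn - inner ℂ p.snd (y.bdry + (β • x.bdry : L2Bdry Ω))

/-- The L²(Ω) and L²(Γ) terms of ⟪v, x⟫ cancel against ⟪ιv, ιx⟫, leaving the gradients. -/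
theorem inner_eq_iff_weakEq (β : LinftyBdry Ω) (x y v : V Ω) :
    inner ℂ v x = inner ℂ (embedding Ω v) (embedding Ω x - boundaryMul β (embedding Ω x)
      - embedding Ω y) ↔ WeakEq β x y v.1 := by
  have h1 : ∀ z : V Ω, inner ℂ (embedding Ω v) (embedding Ω z) =
      inner ℂ v.fn.fn z.fn.fn + inner ℂ v.bdry z.bdry := fun z => by
    rw [embedding_apply, embedding_apply, V.toL2Sum, V.toL2Sum, inner_toLp_prod]
  have h2 : inner ℂ (embedding Ω v) (boundaryMul β (embedding Ω x)) =
      inner ℂ v.bdry (β • x.bdry : L2Bdry Ω) := by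
    rw [boundaryMul_apply, embedding_apply, embedding_apply, V.toL2Sum, V.toL2Sum, inner_toLp_prod,
      inner_zero_right, zero_add, WithLp.toLp_snd]
  have h3 : WeakEq β x y v.1 ↔ inner ℂ v.fn.grad x.fn.grad
    = -inner ℂ v.fn.fn y.fn.fn - inner ℂ v.bdry (y.bdry + (β • x.bdry : L2Bdry Ω)) := Iff.rfl
  rw [h3, inner_sub_right, inner_sub_right, h1, h2, h1, V.inner_eq, inner_add_right]
  constructor
  · intro h
    linear_combination h
  · intro h
    linear_combination h

theorem H1.continuous_fn : Continuous (H1.fn : H1 Ω → L2Dom Ω) :=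
  (WithLp.continuous_fst ..).comp continuous_subtype_val

theorem H1.continuous_grad : Continuous (H1.grad : H1 Ω → L2Vec Ω) :=
  (WithLp.continuous_snd ..).comp continuous_subtype_val

theorem isClosed_weakEq (β : LinftyBdry Ω) (x y : V Ω) : IsClosed {p | WeakEq β x y p} := by
  have h1 : Continuous (fun p : WithLp 2 (H1 Ω × L2Bdry Ω) => p.fst.fn) :=
    H1.continuous_fn.comp (WithLp.continuous_fst ..)
  have h2 : Continuous (fun p : WithLp 2 (H1 Ω × L2Bdry Ω) => p.fst.grad) :=
    H1.continuous_grad.comp (WithLp.continuous_fst ..)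
  have h3 : Continuous (fun p : WithLp 2 (H1 Ω × L2Bdry Ω) => p.snd) := WithLp.continuous_snd ..
  exact isClosed_eq (h2.inner continuous_const)
    ((h1.inner continuous_const).neg.sub (h3.inner continuous_const))

theorem forall_weakEq_iff (β : LinftyBdry Ω) (x y : V Ω) :
    (∀ v : V Ω, WeakEq β x y v.1) ↔ ∀ p ∈ contPairs Ω, WeakEq β x y p := by
  constructor
  · intro h p hp
    have hpV : p ∈ (VSubmodule Ω : Set (WithLp 2 (H1 Ω × L2Bdry Ω))) := by
      rw [coe_VSubmodule]
      exact subset_closure hp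
    exact h ⟨p, hpV⟩
  · intro h v
    have hv : v.1 ∈ (VSubmodule Ω : Set (WithLp 2 (H1 Ω × L2Bdry Ω))) := v.2
    rw [coe_VSubmodule] at hv
    exact closure_minimal h (isClosed_weakEq β x y) hv

/-! ### Equivalence of the weak equation with Green's formula. -/

theorem integral_mul_conj_eq_inner {α : Type*} [MeasurableSpace α] {μ : Measure α}
    (f w : Lp ℂ 2 μ) {v : α → ℂ} (h : w =ᵐ[μ] v) :
    ∫ x, f x * starRingEnd ℂ (v x) ∂μ = inner ℂ w f := by
  rw [L2.inner_def]
  apply integral_congr_ae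
  filter_upwards [h] with x hx
  rw [hx]
  simp

theorem integral_sum_mul_conj_eq_inner (f g : L2Vec Ω) :
    ∫ x in Ω, ∑ i : Fin d, f x i * starRingEnd ℂ (g x i) = inner ℂ g f := by
  rw [L2.inner_def]
  simp [PiLp.inner_apply]

/-- Γ is compact and of finite measure, so a continuous function on it is bounded and square
integrable. Every function admitted in Green's formula thus yields a continuous pair. -/
theorem exists_bdry_of_continuousOn (hb : Bornology.IsBounded Ω)
    (hΓ : (Measure.euclideanHausdorffMeasure (d - 1) :
      Measure (EuclideanSpace ℝ (Fin d))) (frontier Ω) < ⊤)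
    {v : EuclideanSpace ℝ (Fin d) → ℂ} (hv : ContinuousOn v (closure Ω)) :
    ∃ ψ : L2Bdry Ω, ψ =ᵐ[bdryMeasure Ω] v := by
  have hc : IsCompact (frontier Ω) :=
    hb.isCompact_closure.of_isClosed_subset isClosed_frontier frontier_subset_closure
  have hv' := hv.mono frontier_subset_closure
  have : IsFiniteMeasure (bdryMeasure Ω) := ⟨by rwa [Measure.restrict_apply_univ]⟩
  obtain ⟨C, hC⟩ := hc.exists_bound_of_continuousOn hv'
  have hm : MemLp v 2 (bdryMeasure Ω) :=
    MemLp.of_bound (hv'.aestronglyMeasurable isClosed_frontier.measurableSet) C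
      (ae_restrict_of_forall_mem isClosed_frontier.measurableSet hC)
  exact ⟨hm.toLp v, hm.coeFn_toLp⟩

theorem H1.integral_mul_laplacian (u : H1 Ω) {η : EuclideanSpace ℝ (Fin d) → ℂ}
    (hη : IsTestFunction Ω η) : ∫ x in Ω, u.fn x * Laplacian.laplacian η x
      = -∫ x in Ω, ∑ i, u.grad x i * partialDeriv i η x := by
  have h1 : ∀ i, ∫ x in Ω, u.fn x * partialDeriv i (partialDeriv i η) x
      = -∫ x in Ω, u.grad x i * partialDeriv i η x := fun i => u.2 _ (hη.partialDeriv i) i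
  have h2 : ∀ i, Integrable (fun x => u.fn x * partialDeriv i (partialDeriv i η) x)
      (volume.restrict Ω) := fun i =>
    (Lp.memLp u.fn).integrable_mul ((hη.partialDeriv i).memLp_partialDeriv i)
  have h3 : ∀ i, Integrable (fun x => u.grad x i * partialDeriv i η x) (volume.restrict Ω) :=
    fun i => (memLp_coord u.grad i).integrable_mul (hη.memLp_partialDeriv i)
  simp only [laplacian_eq_sum hη, Finset.mul_sum]
  rw [integral_finsetSum _ fun i _ => h2 i, integral_finsetSum _ fun i _ => h3 i,
    ← Finset.sum_neg_distrib]
  exact Finset.sum_congr rfl fun i _ => h1 i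

/-- The strong form of the equation `Δ^W x = y`. -/
def StrongEq (β : LinftyBdry Ω) (x y : V Ω) : Prop :=
  ∃ h : L2Bdry Ω, HasWeakLaplacian x.fn.fn y.fn.fn ∧ HasNormalDeriv x.fn h ∧
    y.bdry = -h - (β • x.bdry : L2Bdry Ω)

theorem StrongEq.weakEq (hΩ : IsOpen Ω) {β : LinftyBdry Ω} {x y : V Ω} (hxy : StrongEq β x y)
    {p : WithLp 2 (H1 Ω × L2Bdry Ω)} (hp : p ∈ contPairs Ω) : WeakEq β x y p := by
  obtain ⟨h, hlap, ⟨f, hf, hgreen⟩, hy⟩ := hxy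
  obtain ⟨v, hv, hpv⟩ := hp
  -- The Laplacian hidden in the normal derivative is the given one.
  obtain rfl := hlap.unique hΩ hf
  have h1 := hgreen v p.fst hv
  rw [integral_mul_conj_eq_inner _ _ hv.ae_eq, integral_mul_conj_eq_inner _ _ hpv,
    integral_sum_mul_conj_eq_inner] at h1
  rw [WeakEq, hy, sub_add_cancel, inner_neg_right]
  linear_combination h1

theorem strongEq_of_weakEq (hb : Bornology.IsBounded Ω)
    (hΓ : (Measure.euclideanHausdorffMeasure (d - 1) :
      Measure (EuclideanSpace ℝ (Fin d))) (frontier Ω) < ⊤) (hΩ : IsOpen Ω)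
    {β : LinftyBdry Ω} {x y : V Ω} (hxy : ∀ p ∈ contPairs Ω, WeakEq β x y p) :
    StrongEq β x y := by
  have hlap : HasWeakLaplacian x.fn.fn y.fn.fn := by
    intro η hη
    -- The conjugate of η is used because the weak equation is antilinear in the test pair. Its
    -- boundary value is 0, as Γ is disjoint from the open set Ω.
    obtain ⟨w, hw, hwg⟩ := hη.star.exists_H1
    have h0 : (0 : L2Bdry Ω) =ᵐ[bdryMeasure Ω] fun x => starRingEnd ℂ (η x) := by
      filter_upwards [Lp.coeFn_zero ℂ 2 (bdryMeasure Ω),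
        ae_restrict_mem isClosed_frontier.measurableSet] with z hz hzΓ
      have hzΩ : z ∉ Ω := fun h => by
        rw [hΩ.frontier_eq] at hzΓ
        exact hzΓ.2 h
      rw [hz, hη.star.eq_zero hzΩ]
      rfl
    have h1 := hxy (WithLp.toLp 2 (w, 0)) ⟨_, ⟨hη.star.contDiff.continuous.continuousOn, hw⟩, h0⟩
    rw [WeakEq, WithLp.toLp_fst, WithLp.toLp_snd, inner_zero_left, sub_zero,
      ← integral_mul_conj_eq_inner _ _ hw, ← integral_sum_mul_conj_eq_inner] at h1
    simp only [Complex.conj_conj] at h1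
    rw [H1.integral_mul_laplacian _ hη, ← neg_eq_iff_eq_neg.2 h1]
    congr 1
    apply integral_congr_ae
    filter_upwards [ae_all_iff.2 hwg] with x hx
    refine Finset.sum_congr rfl fun i _ => ?_
    rw [hx i, hη.partialDeriv_star, Complex.conj_conj]
  -- The boundary component of the equation forces this normal derivative; testing with all
  -- continuous pairs then gives Green's formula.
  refine ⟨-y.bdry - (β • x.bdry : L2Bdry Ω), hlap, ⟨y.fn.fn, hlap, fun v w hvw => ?_⟩, by abel⟩
  obtain ⟨ψ, hψ⟩ := exists_bdry_of_continuousOn hb hΓ hvw.continuousOn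
  have h1 := hxy (WithLp.toLp 2 (w, ψ)) ⟨v, hvw, hψ⟩
  rw [integral_mul_conj_eq_inner _ _ hvw.ae_eq, integral_mul_conj_eq_inner _ _ hψ,
    integral_sum_mul_conj_eq_inner]
  rw [WeakEq, WithLp.toLp_fst, WithLp.toLp_snd, inner_add_right] at h1
  rw [inner_sub_right, inner_neg_right, h1]
  ring

theorem V.bdry_mem_Tr (x : V Ω) : x.bdry ∈ Tr x.fn := x.2

theorem mem_wentzellLaplacian (β : LinftyBdry Ω) (p q : L2Sum Ω) :
    (p, q) ∈ wentzellLaplacian Ω β ↔ ∃ (u : H1 Ω) (h : L2Bdry Ω), u.fn = p.fst ∧ p.snd ∈ Tr u ∧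
      HasWeakLaplacian u.fn q.fst ∧ HasNormalDeriv u h ∧
      q.snd = -h - (β • p.snd : L2Bdry Ω) := Iff.rfl

theorem mem_partGraph {X Y : Type*} (ι : Y → X) (G : Set (X × X)) (x y : Y) :
    (x, y) ∈ partGraph ι G ↔ (ι x, ι y) ∈ G := Iff.rfl

theorem mem_partGraph_iff (hΩ : IsOpen Ω) (β : LinftyBdry Ω) (x y : V Ω) :
    (x, y) ∈ partGraph V.toL2Sum (wentzellLaplacian Ω β) ↔ StrongEq β x y := by
  rw [mem_partGraph, mem_wentzellLaplacian, V.toL2Sum_fst, V.toL2Sum_snd, V.toL2Sum_fst,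
    V.toL2Sum_snd]
  constructor
  · rintro ⟨u, h, hu, -, hlap, hn, hy⟩
    obtain rfl : u = x.fn := H1.fn_injective hΩ hu
    exact ⟨h, hlap, hn, hy⟩
  · rintro ⟨h, hlap, hn, hy⟩
    exact ⟨x.fn, h, rfl, x.bdry_mem_Tr, hlap, hn, hy⟩

end

end Wentzell

/-! ### The theorem. -/

theorem theorem5p1 (d : ℕ) (hd : 1 ≤ d) (Ω : Set (EuclideanSpace ℝ (Fin d)))
    (hΩ_open : IsOpen Ω) (hΩ_bdd : Bornology.IsBounded Ω)
    (hΓ : (Measure.euclideanHausdorffMeasure (d - 1) :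
      Measure (EuclideanSpace ℝ (Fin d))) (frontier Ω) < ⊤)
    (β : Wentzell.LinftyBdry Ω) :
    ∃ A : Wentzell.V Ω →ₗ.[ℂ] Wentzell.V Ω,
      -- `A` is the part of `Δ^W` in `V`
      (A.graph : Set (Wentzell.V Ω × Wentzell.V Ω)) =
        partGraph Wentzell.V.toL2Sum (Wentzell.wentzellLaplacian Ω β) ∧
      Semigroup.GeneratesHolomorphicC0Semigroup A ∧
      -- explicit description of the domain, with the Wentzell condition in the sense of traces
      (∀ x : Wentzell.V Ω, x ∈ A.domain ↔
        ∃ (f : Wentzell.H1 Ω) (h : Wentzell.L2Bdry Ω),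
          Wentzell.HasWeakLaplacian x.fn.fn f.fn ∧ Wentzell.HasNormalDeriv x.fn h ∧
          -h - (β • x.bdry : Wentzell.L2Bdry Ω) ∈ Wentzell.Tr f) ∧
      -- explicit description of the action
      (∀ x : A.domain, ∃ h : Wentzell.L2Bdry Ω,
        Wentzell.HasWeakLaplacian (x : Wentzell.V Ω).fn.fn (A x).fn.fn ∧
        Wentzell.HasNormalDeriv (x : Wentzell.V Ω).fn h ∧
        (A x).bdry = -h - (β • (x : Wentzell.V Ω).bdry : Wentzell.L2Bdry Ω) ∧
        -h - (β • (x : Wentzell.V Ω).bdry : Wentzell.L2Bdry Ω) ∈ Wentzell.Tr (A x).fn) := by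
  obtain ⟨A, hgen, hA⟩ := Semigroup.exists_generator_of_embedding (Wentzell.embedding Ω)
    (Wentzell.embedding_injective hΩ_open) Wentzell.norm_embedding_le (Wentzell.boundaryMul β)
  have hgraph : ∀ x y, (x, y) ∈ A.graph ↔ Wentzell.StrongEq β x y := by
    intro x y
    rw [hA]
    simp only [Wentzell.inner_eq_iff_weakEq]
    rw [Wentzell.forall_weakEq_iff]
    exact ⟨Wentzell.strongEq_of_weakEq hΩ_bdd hΓ hΩ_open, fun h p hp => h.weakEq hΩ_open hp⟩
  refine ⟨A, ?_, hgen, fun x => ?_, fun x => ?_⟩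
  · ext ⟨x, y⟩
    rw [Wentzell.mem_partGraph_iff hΩ_open]
    exact hgraph x y
  · rw [LinearPMap.mem_domain_iff]
    constructor
    · rintro ⟨y, hy⟩
      obtain ⟨h, hlap, hn, hyb⟩ := (hgraph x y).1 hy
      refine ⟨y.fn, h, hlap, hn, ?_⟩
      rw [← hyb]
      exact y.2
    · rintro ⟨f, h, hlap, hn, htr⟩
      -- The trace condition says precisely that the prospective image is an element of V.
      exact ⟨⟨WithLp.toLp 2 (f, _), htr⟩, (hgraph _ _).2 ⟨h, hlap, hn, rfl⟩⟩
  · obtain ⟨h, hlap, hn, hyb⟩ := (hgraph _ _).1 (A.mem_graph x)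
    refine ⟨h, hlap, hn, hyb, ?_⟩
    rw [← hyb]
    exact (A x).2
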